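/- Let $\mathbb{K}$ be $\mathbb{R}$ or $\mathbb{C}$, let $X$ be a metric space with base point $0$, let $E$ be a Banach space over $\mathbb{K}$ with dual $E^*$, let $1\le p\le\infty$ and let $p'$ be the conjugate index of $p$. Write $\mathrm{Lip}(f)$ for the least Lipschitz constant of a map $f$, $\mathrm{Lip}_0(X,F)$ for the space of Lipschitz maps $f\colon X\to F$ with $f(0)=0$, and $X^\#=\mathrm{Lip}_0(X,\mathbb{K})$. Definitions. For $x,y\in X$ and $e\in E$ let $\delta_{(x,y)}\boxtimes e$ be the linear functional $f\mapsto\langle f(x)-f(y),e\rangle$ on $\mathrm{Lip}_0(X,E^*)$, and let $X\boxtimes E$ be the linear span of all these functionals. A norm $\alpha$ on $X\boxtimes E$ is a Lipschitz cross-norm if $\alpha(\delta_{(x,y)}\boxtimes e)=d(x,y)\|e\|$ for all $x,y,e$; then $X\widehat{\boxtimes}_\alpha E$ denotes the completion of $(X\boxtimes E,\alpha)$. For $1\le q\le\infty$, $\lambda_i,\mu_j\in\mathbb{R}$ and $y_i,y_i',x_j,x_j'\in X$, write $(\lambda_i,y_i,y_i')_{i=1}^n\prec_q(\mu_j,x_j,x_j')_{j=1}^m$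 if $$\Big\|\big(\lambda_i[g(y_i)-g(y_i')]\big)_{i=1}^n\Big\|_{\ell_q^n}\le\Big\|\big(\mu_j[g(x_j)-g(x_j')]\big)_{j=1}^m\Big\|_{\ell_q^m}\quad\text{for every } g\in X^\#.$$ For $u\in X\boxtimes E$ let $$w_p(u)=\inf\Big\{\big\|(\|e_i\|)_{i=1}^n\big\|_{\ell_p^n}\,\big\|(\mu_j d(x_j,x_j'))_{j=1}^m\big\|_{\ell_{p'}^m}\Big\},$$ the infimum being taken over all $n,m$, $e_i\in E$, $\lambda_i,\mu_j\in\mathbb{R}$ and $y_i,y_i',x_j,x_j'\in X$ such that $u=\sum_{i=1}^n\lambda_i\,\delta_{(y_i,y_i')}\boxtimes e_i$ and $(\lambda_i,y_i,y_i')_{i=1}^n\prec_{p'}(\mu_j,x_j,x_j')_{j=1}^m$. A map $f\colon X\to E^*$ with $f(0)=0$ belongs to $\mathrm{Lip}_{w_p}(X,E^*)$ if there is $C\ge0$ with $\big|\sum_{i=1}^n\langle f(x_i)-f(y_i),e_i\rangle\big|\le C\,w_p\big(\sum_{i=1}^n\delta_{(x_i,y_i)}\boxtimes e_i\big)$ for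 all finite families $x_i,y_i\in X$, $e_i\in E$; the infimum of such $C$ is $\mathrm{Lip}_{w_p}(f)$. For $1\le q\le\infty$, $\Gamma_q^{\mathrm{Lip}}(X,E^*)$ is the set of all $f\in\mathrm{Lip}_0(X,E^*)$ that factor as $f=S\circ R$ with Lipschitz maps $R\colon X\to Z$ and $S\colon Z\to E^*$, where $Z$ is a subset of a space $L_q(\mu)$ (of $\mathbb{K}$-valued functions) for some measure $\mu$; $\gamma_q^{\mathrm{Lip}}(f)$ is the infimum of $\mathrm{Lip}(R)\,\mathrm{Lip}(S)$ over all such factorizations and all measures $\mu$. Theorem. (1) $\mathrm{Lip}_{w_p}(X,E^*)=\Gamma_{p'}^{\mathrm{Lip}}(X,E^*)$, and $\mathrm{Lip}_{w_p}(f)=\gamma_{p'}^{\mathrm{Lip}}(f)$ for every $f\in\mathrm{Lip}_{w_p}(X,E^*)$. (2) $w_{p'}$ is a Lipschitz cross-norm on $X\boxtimes E$, the set $\Gamma_p^{\mathrm{Lip}}(X,E^*)$ is a linear space, and, with the norm $\gamma_p^{\mathrm{Lip}}$, it is isometrically isomorphic to $(X\widehat{\boxtimes}_{w_{p'}}E)^*$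 by a linear bijection $\Lambda$ with $\Lambda(f)(\delta_{(x,y)}\boxtimes e)=\langle f(x)-f(y),e\rangle$ for all $f\in\Gamma_p^{\mathrm{Lip}}(X,E^*)$, $x,y\in X$, $e\in E$. -/

import Mathlib

open scoped NNReal ENNReal
open MeasureTheory

universe u v w k

namespace LipTensor

section Lipschitz

/-- The least Lipschitz constant `Lip(f)` of a Lipschitz map `f`. -/
noncomputable def lipConst {X : Type u} {Y : Type v} [PseudoEMetricSpace X] [PseudoEMetricSpace Y]
    (f : X → Y) : ℝ :=
  ((sInf {C : ℝ≥0 | LipschitzWith C f} : ℝ≥0) : ℝ)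

/-- `Lip₀(X, F)`: the Lipschitz maps `X → F` that send the base point `x₀` of `X` to `0`,
as a linear space. For `F = 𝕂` this is the Lipschitz dual `X^#`. -/
def Lip0 (𝕂 : Type k) [RCLike 𝕂] {X : Type u} [MetricSpace X] (x₀ : X)
    (F : Type v) [NormedAddCommGroup F] [NormedSpace 𝕂 F] : Submodule 𝕂 (X → F) where
  carrier := {f | f x₀ = 0 ∧ ∃ C : ℝ≥0, LipschitzWith C f}
  zero_mem' := ⟨rfl, 0, LipschitzWith.const 0⟩
  add_mem' := by
    rintro f g ⟨hf, C, hC⟩ ⟨hg, D, hD⟩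
    exact ⟨by simp [hf, hg], C + D, hC.add hD⟩
  smul_mem' := by
    rintro c f ⟨hf, C, hC⟩
    refine ⟨by simp [hf], ‖c‖₊ * C, ?_⟩
    exact (lipschitzWith_smul c).comp hC

end Lipschitz

section Tensor

variable {𝕂 : Type k} [RCLike 𝕂] {X : Type u} [MetricSpace X]
  {E : Type v} [NormedAddCommGroup E] [NormedSpace 𝕂 E]

/-- The linear functional `δ_{(x,y)} ⊠ e` on `Lip₀(X, E*)`, `f ↦ ⟨f x - f y, e⟩`. -/
noncomputable def deltaFun (x₀ x y : X) (e : E) : Lip0 𝕂 x₀ (StrongDual 𝕂 E) →ₗ[𝕂] 𝕂 where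
  toFun f := (f.1 x - f.1 y) e
  map_add' f g := by
    simp only [Submodule.coe_add, Pi.add_apply, sub_apply, add_apply]
    ring
  map_smul' c f := by
    simp only [SetLike.val_smul, Pi.smul_apply, sub_apply,
      smul_apply, smul_eq_mul, RingHom.id_apply]
    ring

variable (𝕂 E) in
/-- The Lipschitz tensor product `X ⊠ E`: the linear span of the functionals
`δ_{(x,y)} ⊠ e` on `Lip₀(X, E*)`. -/
noncomputable def Tensor (x₀ : X) : Submodule 𝕂 (Lip0 𝕂 x₀ (StrongDual 𝕂 E) →ₗ[𝕂] 𝕂) :=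
  Submodule.span 𝕂 {u | ∃ (x y : X) (e : E), u = deltaFun x₀ x y e}

variable (𝕂) in
/-- `δ_{(x,y)} ⊠ e` as an element of `X ⊠ E`. -/
noncomputable def delta (x₀ x y : X) (e : E) : Tensor 𝕂 E x₀ :=
  ⟨deltaFun x₀ x y e, Submodule.subset_span ⟨x, y, e, rfl⟩⟩

variable (𝕂) in
/-- `(a_i, y_i, y_i') ≺_q (b_j, x_j, x_j')`: for all `g ∈ X^#`, the `ℓ_q`-norm of
`(a_i (g y_i - g y_i'))_i` is at most the `ℓ_q`-norm of `(b_j (g x_j - g x_j'))_j`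
(the maximum of the moduli if `q = ∞`). -/
def Dominated (x₀ : X) (q : ℝ≥0∞) {n m : ℕ} (a : Fin n → ℝ) (y y' : Fin n → X)
    (b : Fin m → ℝ) (x x' : Fin m → X) : Prop :=
  ∀ g ∈ Lip0 𝕂 x₀ 𝕂,
    ‖WithLp.toLp q (fun i => (a i : 𝕂) * (g (y i) - g (y' i)))‖ ≤
      ‖WithLp.toLp q (fun j => (b j : 𝕂) * (g (x j) - g (x' j)))‖

/-- The function `w_p` on `X ⊠ E`. -/
noncomputable def wNorm {x₀ : X} (p : ℝ≥0∞) (u : Tensor 𝕂 E x₀) : ℝ :=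
  sInf {c : ℝ | ∃ (n m : ℕ) (a : Fin n → ℝ) (y y' : Fin n → X) (e : Fin n → E)
    (b : Fin m → ℝ) (x x' : Fin m → X),
    u = ∑ i, (a i : 𝕂) • delta 𝕂 x₀ (y i) (y' i) (e i) ∧
    Dominated 𝕂 x₀ p.conjExponent a y y' b x x' ∧
    c = ‖WithLp.toLp p e‖ * ‖WithLp.toLp p.conjExponent (fun j => b j * dist (x j) (x' j))‖}

/-- `α` is a Lipschitz cross-norm on `X ⊠ E`. -/
structure IsLipschitzCrossNorm {x₀ : X} (α : Tensor 𝕂 E x₀ → ℝ) : Prop where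
  add_le : ∀ u v, α (u + v) ≤ α u + α v
  smul_eq : ∀ (c : 𝕂) u, α (c • u) = ‖c‖ * α u
  eq_zero : ∀ u, α u = 0 → u = 0
  cross : ∀ (x y : X) (e : E), α (delta 𝕂 x₀ x y e) = dist x y * ‖e‖

theorem IsLipschitzCrossNorm.nonneg {x₀ : X} {α : Tensor 𝕂 E x₀ → ℝ}
    (h : IsLipschitzCrossNorm α) (u : Tensor 𝕂 E x₀) : 0 ≤ α u := by
  have h0 : α 0 = 0 := by simpa using h.smul_eq 0 0
  have h1 := h.add_le u ((-1 : 𝕂) • u)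
  have h2 : u + (-1 : 𝕂) • u = 0 := by
    have h3 := neg_one_smul 𝕂 u
    rw [h3, add_neg_cancel]
  rw [h.smul_eq, h2, h0] at h1
  simp only [norm_neg, norm_one, one_mul] at h1
  linarith

/-- `X ⊠_α E`: the space `X ⊠ E` normed by the Lipschitz cross-norm `α`. -/
def NormedTensor {x₀ : X} {α : Tensor 𝕂 E x₀ → ℝ} (_h : IsLipschitzCrossNorm α) :
    Type (max u v k) :=
  Tensor 𝕂 E x₀

namespace NormedTensor

variable {x₀ : X} {α : Tensor 𝕂 E x₀ → ℝ} (h : IsLipschitzCrossNorm α)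

noncomputable instance : AddCommGroup (NormedTensor h) := inferInstanceAs (AddCommGroup (Tensor 𝕂 E x₀))

noncomputable instance : Module 𝕂 (NormedTensor h) := inferInstanceAs (Module 𝕂 (Tensor 𝕂 E x₀))

instance : Norm (NormedTensor h) := ⟨α⟩

theorem core : NormedSpace.Core 𝕂 (NormedTensor h) where
  norm_nonneg u := h.nonneg u
  norm_smul c u := h.smul_eq c u
  norm_triangle u v := h.add_le u v
  norm_eq_zero_iff u := by
    refine ⟨h.eq_zero u, ?_⟩
    rintro rfl
    have h0 : α 0 = 0 := by simpa using h.smul_eq 0 0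
    exact h0

noncomputable instance : NormedAddCommGroup (NormedTensor h) := NormedAddCommGroup.ofCore (core h)

noncomputable instance : NormedSpace 𝕂 (NormedTensor h) := NormedSpace.ofCore (core h)

end NormedTensor

/-- `X ⊠̂_α E`: the completion of `X ⊠_α E`. -/
abbrev CompletedTensor {x₀ : X} {α : Tensor 𝕂 E x₀ → ℝ} (h : IsLipschitzCrossNorm α) :
    Type (max u v k) :=
  UniformSpace.Completion (NormedTensor h)

/-- `δ_{(x,y)} ⊠ e` as an element of `X ⊠̂_α E`. -/
noncomputable def completedDelta {x₀ : X} {α : Tensor 𝕂 E x₀ → ℝ} (h : IsLipschitzCrossNorm α)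
    (x y : X) (e : E) : CompletedTensor h :=
  ((show NormedTensor h from delta 𝕂 x₀ x y e : NormedTensor h) : CompletedTensor h)

/-- `C` is an admissible constant in the definition of an `α`-Lipschitz operator. -/
def AlphaBound {x₀ : X} (α : Tensor 𝕂 E x₀ → ℝ) (f : X → StrongDual 𝕂 E) (C : ℝ) : Prop :=
  ∀ (n : ℕ) (x y : Fin n → X) (e : Fin n → E),
    ‖∑ i, (f (x i) - f (y i)) (e i)‖ ≤ C * α (∑ i, delta 𝕂 x₀ (x i) (y i) (e i))

/-- `Lip_α(X, E*)`: the set of `α`-Lipschitz operators. -/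
def alphaLip {x₀ : X} (α : Tensor 𝕂 E x₀ → ℝ) : Set (X → StrongDual 𝕂 E) :=
  {f | f x₀ = 0 ∧ ∃ C : ℝ, 0 ≤ C ∧ AlphaBound α f C}

/-- The `α`-Lipschitz norm `Lip_α(f)`. -/
noncomputable def alphaLipNorm {x₀ : X} (α : Tensor 𝕂 E x₀ → ℝ) (f : X → StrongDual 𝕂 E) : ℝ :=
  sInf {C : ℝ | 0 ≤ C ∧ AlphaBound α f C}

end Tensor

section Factorization

variable (𝕂 : Type k) [RCLike 𝕂] {X : Type u} [MetricSpace X] {Y : Type v} [MetricSpace Y]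

/-- The numbers `Lip(R) · Lip(S)`, over all Lipschitz factorizations `f = S ∘ R` of `f` through a
subset `Z` of a space `L_q(μ)` (of `𝕂`-valued functions), `μ` a measure on some space `Ω`. -/
def factorCosts (q : ℝ≥0∞) [Fact (1 ≤ q)] (f : X → Y) : Set ℝ :=
  {c | ∃ (Ω : Type w) (_ : MeasurableSpace Ω) (μ : Measure Ω) (Z : Set (Lp 𝕂 q μ))
    (R : X → Z) (S : Z → Y),
    (∃ C : ℝ≥0, LipschitzWith C R) ∧ (∃ C : ℝ≥0, LipschitzWith C S) ∧
    f = S ∘ R ∧ c = lipConst R * lipConst S}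

/-- `Γ_q^Lip(X, Y)` for pointed metric spaces `(X, x₀)` and `(Y, y₀)`: the base-point preserving
Lipschitz maps with a Lipschitz factorization through a subset of some `L_q(μ)`. -/
def Gam (q : ℝ≥0∞) [Fact (1 ≤ q)] (x₀ : X) (y₀ : Y) : Set (X → Y) :=
  {f | f x₀ = y₀ ∧ (∃ C : ℝ≥0, LipschitzWith C f) ∧ (factorCosts.{u, v, w, k} 𝕂 q f).Nonempty}

/-- `γ_q^Lip(f)`. -/
noncomputable def gam (q : ℝ≥0∞) [Fact (1 ≤ q)] (f : X → Y) : ℝ :=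
  sInf (factorCosts.{u, v, w, k} 𝕂 q f)

end Factorization

instance fact_one_le_conjExponent (p : ℝ≥0∞) : Fact (1 ≤ p.conjExponent) :=
  ⟨by simp [ENNReal.conjExponent]⟩

end LipTensor

open LipTensor

namespace LipTensor

/-! ### Finite `ℓ_q` norms: monotonicity, Hölder and its converse, concatenation -/

section FiniteLp

variable {ι : Type*} [Fintype ι] {F G : Type*} [SeminormedAddCommGroup F]
  [SeminormedAddCommGroup G]

/-! Evaluating tensors at a map turns an `α`-Lipschitz bound into boundedness of a linear functional
on `X ⊠ E`. So for every Lipschitz cross-norm `α` the `α`-Lipschitz maps form the dual of the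
completion (`alphaLipDualEquiv`). It remains to see that `w_p` is such a norm and that a map is
`w_p`-bounded with constant `C` exactly when it factors through a subset of some `L_{p'}` at cost at
most `C`. Part (2) is then part (1) for `p'`, since `p'' = p`.

From a factorization to a bound: a domination `≺_{p'}` involves finitely many points, so it holds
for all functions on `X`, not only Lipschitz ones. Applied to `z ↦ R z ω` and integrated over `ω`,
it becomes a domination for the norms `‖R y - R y'‖` (`Dominated.lp`), and Hölder's inequality
finishes.

From a bound to a factorization: for `p = 1` the Kuratowski embedding into `ℓ_∞` suffices. For `p ≠
1` put `s = p' < ∞`. Converse Hölder (`AlphaBound.norm_toLp_le`) shows that `∑ α_i |g y_i - g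
y_i'|^s ≤ ∑ β_j |g x_j - g x_j'|^s` for all `g ∈ X^#` implies `∑ α_i ‖f y_i - f y_i'‖^s ≤ ∑ β_j (C
d(x_j, x_j'))^s`. This is the compatibility that M. Riesz extension needs to produce a positive
functional `I` on the `s`-homogeneous functions on `𝕂^X` with `‖f x - f y‖^s ≤ I(|g x - g y|^s) ≤ (C
d(x, y))^s`.

If a measure `μ` on `𝕂^X` represents `I` on these functions, the coordinate `R x : g ↦ g x` lies in
`L_s(μ)`, `R` is `C`-Lipschitz and `f` is a 1-Lipschitz function of `R`. To find `μ`, take by Zorn a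
maximal measure with `∫ h dμ ≤ I h` for all `h ≥ 0`. If the remainder `I - ∫ dμ` were positive on
some `|g x|^s`, passing to the ratios `g y / g x` in the compact space `(𝕂 ∪ {∞})^X` and applying
Riesz–Markov would give a further measure below it (`exists_band_measure`), against maximality. So
the remainder kills every `|g x|^s`, hence every `|g x - g y|^s`. -/

theorem toReal_pos_of_fact {q : ℝ≥0∞} [h : Fact (1 ≤ q)] (hq : q ≠ ∞) : 0 < q.toReal :=
  ENNReal.toReal_pos (zero_lt_one.trans_le h.out).ne' hq

theorem norm_toLp_rpow {q : ℝ≥0∞} [Fact (1 ≤ q)] (hq : q ≠ ∞) (v : ι → F) :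
    ‖WithLp.toLp q v‖ ^ q.toReal = ∑ i, ‖v i‖ ^ q.toReal := by
  have h := toReal_pos_of_fact hq
  rw [PiLp.norm_eq_sum h, ← Real.rpow_mul (by positivity), one_div, inv_mul_cancel₀ h.ne',
    Real.rpow_one]

theorem norm_toLp_le_iff_rpow {q : ℝ≥0∞} [Fact (1 ≤ q)] (hq : q ≠ ∞) (v : ι → F) {M : ℝ}
    (hM : 0 ≤ M) :
    ‖WithLp.toLp q v‖ ≤ M ↔ ∑ i, ‖v i‖ ^ q.toReal ≤ M ^ q.toReal := by
  rw [← norm_toLp_rpow hq, Real.rpow_le_rpow_iff (norm_nonneg _) hM (toReal_pos_of_fact hq)]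

theorem norm_toLp_top_le_iff (v : ι → F) {M : ℝ} (hM : 0 ≤ M) :
    ‖WithLp.toLp ∞ v‖ ≤ M ↔ ∀ i, ‖v i‖ ≤ M := by
  rw [PiLp.norm_toLp, pi_norm_le_iff_of_nonneg hM]

theorem norm_toLp_mono {q : ℝ≥0∞} [Fact (1 ≤ q)] {v : ι → F} {w : ι → G}
    (h : ∀ i, ‖v i‖ ≤ ‖w i‖) : ‖WithLp.toLp q v‖ ≤ ‖WithLp.toLp q w‖ := by
  obtain rfl | hq := eq_or_ne q ∞
  · rw [norm_toLp_top_le_iff _ (norm_nonneg _)]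
    exact fun i => (h i).trans (PiLp.norm_apply_le (WithLp.toLp ∞ w) i)
  · rw [norm_toLp_le_iff_rpow hq _ (norm_nonneg _), norm_toLp_rpow hq]
    exact Finset.sum_le_sum fun i _ => Real.rpow_le_rpow (norm_nonneg _) (h i) (by positivity)

theorem norm_toLp_const_smul {𝕜 : Type*} [NormedField 𝕜] [NormedSpace 𝕜 F] {q : ℝ≥0∞}
    [Fact (1 ≤ q)] (t : 𝕜) (v : ι → F) :
    ‖WithLp.toLp q (fun i => t • v i)‖ = ‖t‖ * ‖WithLp.toLp q v‖ := by
  rw [← norm_smul]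
  rfl

theorem norm_toLp_mul_le {q : ℝ≥0∞} [Fact (1 ≤ q)] {v : ι → F} {b : ι → ℝ} {K : ℝ} (hK : 0 ≤ K)
    (h : ∀ i, ‖v i‖ ≤ K * |b i|) : ‖WithLp.toLp q v‖ ≤ K * ‖WithLp.toLp q b‖ := by
  calc ‖WithLp.toLp q v‖ ≤ ‖WithLp.toLp q (fun i => K • b i)‖ :=
        norm_toLp_mono fun i => by
          rw [norm_smul, Real.norm_of_nonneg hK, Real.norm_eq_abs]; exact h i
    _ = _ := by rw [norm_toLp_const_smul, Real.norm_of_nonneg hK]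

theorem sum_norm_mul_norm_le {p q : ℝ≥0∞} [Fact (1 ≤ p)] [Fact (1 ≤ q)]
    (hpq : p.HolderConjugate q) (v : ι → F) (w : ι → G) :
    ∑ i, ‖v i‖ * ‖w i‖ ≤ ‖WithLp.toLp p v‖ * ‖WithLp.toLp q w‖ := by
  obtain rfl | hp := eq_or_ne p ∞
  · obtain rfl : q = 1 := ENNReal.HolderConjugate.unique ∞ q 1
    rw [PiLp.norm_eq_of_L1, Finset.mul_sum]
    exact Finset.sum_le_sum fun i _ => mul_le_mul_of_nonneg_right
      (PiLp.norm_apply_le (WithLp.toLp ∞ v) i) (norm_nonneg _)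
  obtain rfl | hq := eq_or_ne q ∞
  · obtain rfl : p = 1 := ENNReal.HolderConjugate.unique ∞ p 1
    rw [PiLp.norm_eq_of_L1, Finset.sum_mul]
    exact Finset.sum_le_sum fun i _ => mul_le_mul_of_nonneg_left
      (PiLp.norm_apply_le (WithLp.toLp ∞ w) i) (norm_nonneg _)
  · have h := ENNReal.HolderConjugate.toReal_of_ne_top hp hq
    rw [PiLp.norm_eq_sum h.pos, PiLp.norm_eq_sum h.symm.pos]
    exact Real.inner_le_Lp_mul_Lq_of_nonneg _ h (fun i _ => norm_nonneg _) fun i _ => norm_nonneg _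

/-- Converse of Hölder's inequality, tested on nonnegative vectors only. The condition `p ≠ 1`
leaves out `q = ∞`, a case treated separately by the Kuratowski embedding. -/
theorem norm_toLp_le_of_forall_sum_mul_le {p q : ℝ≥0∞} [Fact (1 ≤ p)] [Fact (1 ≤ q)]
    (hpq : p.HolderConjugate q) (hp : p ≠ 1) {s : ι → ℝ} (hs : ∀ i, 0 ≤ s i) {M : ℝ} (hM : 0 ≤ M)
    (h : ∀ t : ι → ℝ, (∀ i, 0 ≤ t i) → ∑ i, s i * t i ≤ M * ‖WithLp.toLp p t‖) :
    ‖WithLp.toLp q s‖ ≤ M := by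
  obtain rfl | hp' := eq_or_ne p ∞
  · obtain rfl : q = 1 := ENNReal.HolderConjugate.unique ∞ q 1
    rw [PiLp.norm_eq_of_L1]
    have h1 := h (fun _ => 1) (fun _ => zero_le_one)
    have h2 : ‖WithLp.toLp ∞ (fun _ : ι => (1 : ℝ))‖ ≤ 1 :=
      (norm_toLp_top_le_iff _ zero_le_one).2 fun i => by simp
    calc ∑ i, ‖s i‖ = ∑ i, s i * 1 := by simp [abs_of_nonneg, hs]
      _ ≤ M * 1 := h1.trans (mul_le_mul_of_nonneg_left h2 hM)
      _ = M := mul_one M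
  · have hq : q ≠ ∞ := by
      rintro rfl
      exact hp (ENNReal.HolderConjugate.unique ∞ p 1)
    have hc := (ENNReal.HolderConjugate.toReal_of_ne_top hp' hq).symm
    -- The dual description of the `ℓ_q` norm is a maximum, so some `t` in the unit ball of `ℓ_p`
    -- attains it.
    obtain ⟨⟨t, ht, hts⟩, -⟩ := NNReal.isGreatest_Lp Finset.univ (fun i => (s i).toNNReal) hc
    have hts' := congrArg NNReal.toReal hts
    have ht' : ‖WithLp.toLp p (fun i => (t i : ℝ))‖ ≤ 1 := by
      rw [norm_toLp_le_iff_rpow hp' _ zero_le_one, Real.one_rpow]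
      have : ((∑ i, t i ^ p.toReal : ℝ≥0) : ℝ) ≤ 1 := by exact_mod_cast ht
      simpa using this
    rw [PiLp.norm_eq_sum hc.pos]
    calc (∑ i, ‖s i‖ ^ q.toReal) ^ (1 / q.toReal) = ∑ i, s i * t i := by
          simp only [NNReal.coe_sum, NNReal.coe_mul, NNReal.coe_rpow, Real.coe_toNNReal _ (hs _)]
            at hts'
          simp only [Real.norm_of_nonneg (hs _)]
          exact hts'.symm
      _ ≤ M * 1 := (h _ fun i => (t i).2).trans (mul_le_mul_of_nonneg_left ht' hM)
      _ = M := mul_one M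

/-- Writing the bounds as powers `q.toReal⁻¹` treats all `q` at once: for `q = ∞` the exponent is
`0`, so each bound reads `≤ 1`. -/
theorem norm_toLp_append_le {q : ℝ≥0∞} [Fact (1 ≤ q)] {n m : ℕ} {v : Fin n → F} {w : Fin m → F}
    {c d : ℝ} (hc : 0 ≤ c) (hd : 0 ≤ d) (hv : ‖WithLp.toLp q v‖ ≤ c ^ q.toReal⁻¹)
    (hw : ‖WithLp.toLp q w‖ ≤ d ^ q.toReal⁻¹) :
    ‖WithLp.toLp q (Fin.append v w)‖ ≤ (c + d) ^ q.toReal⁻¹ := by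
  obtain rfl | hq := eq_or_ne q ∞
  · simp only [ENNReal.toReal_top, inv_zero, Real.rpow_zero] at *
    rw [norm_toLp_top_le_iff _ zero_le_one] at *
    exact Fin.addCases (by simpa using hv) (by simpa using hw)
  · have hq' := (toReal_pos_of_fact hq).ne'
    rw [norm_toLp_le_iff_rpow hq _ (by positivity), Real.rpow_inv_rpow (by positivity) hq'] at *
    rw [Fin.sum_univ_add]
    simpa using add_le_add hv hw

theorem norm_toLp_append_mono {q : ℝ≥0∞} [Fact (1 ≤ q)] {n m n' m' : ℕ} {v : Fin n → F}
    {w : Fin m → F} {v' : Fin n' → G} {w' : Fin m' → G}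
    (hv : ‖WithLp.toLp q v‖ ≤ ‖WithLp.toLp q v'‖) (hw : ‖WithLp.toLp q w‖ ≤ ‖WithLp.toLp q w'‖) :
    ‖WithLp.toLp q (Fin.append v w)‖ ≤ ‖WithLp.toLp q (Fin.append v' w')‖ := by
  obtain rfl | hq := eq_or_ne q ∞
  · rw [norm_toLp_top_le_iff _ (norm_nonneg _)] at *
    have key := (norm_toLp_top_le_iff (Fin.append v' w') (norm_nonneg _)).1 le_rfl
    have h1 : ‖WithLp.toLp ∞ v'‖ ≤ ‖WithLp.toLp ∞ (Fin.append v' w')‖ :=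
      (norm_toLp_top_le_iff _ (norm_nonneg _)).2 fun i => by simpa using key (Fin.castAdd m' i)
    have h2 : ‖WithLp.toLp ∞ w'‖ ≤ ‖WithLp.toLp ∞ (Fin.append v' w')‖ :=
      (norm_toLp_top_le_iff _ (norm_nonneg _)).2 fun i => by simpa using key (Fin.natAdd n' i)
    exact Fin.addCases (fun i => by simpa using (hv i).trans h1)
      (fun i => by simpa using (hw i).trans h2)
  · rw [norm_toLp_le_iff_rpow hq _ (norm_nonneg _), norm_toLp_rpow hq] at *
    rw [Fin.sum_univ_add, Fin.sum_univ_add]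
    simpa using add_le_add hv hw

theorem inv_toReal_add_inv_toReal {p q : ℝ≥0∞} (hpq : p.HolderConjugate q) :
    p.toReal⁻¹ + q.toReal⁻¹ = 1 := by
  have h := ENNReal.HolderConjugate.inv_add_inv_eq_one p q
  have hp : p⁻¹ ≠ ∞ := fun h' => by simp [h'] at h
  have hq : q⁻¹ ≠ ∞ := fun h' => by simp [h'] at h
  rw [← ENNReal.toReal_inv, ← ENNReal.toReal_inv, ← ENNReal.toReal_add hp hq, h, ENNReal.toReal_one]

end FiniteLp

/-! ### `w_p` is a Lipschitz cross-norm -/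

section TensorNorm

variable {𝕂 : Type k} [RCLike 𝕂] {X : Type u} [MetricSpace X]
  {E : Type v} [NormedAddCommGroup E] [NormedSpace 𝕂 E] {x₀ : X}

theorem delta_apply (x y : X) (e : E) (f : Lip0 𝕂 x₀ (StrongDual 𝕂 E)) :
    (delta 𝕂 x₀ x y e).1 f = (f.1 x - f.1 y) e := rfl

theorem sum_smul_delta_apply {n : ℕ} (a : Fin n → ℝ) (y y' : Fin n → X) (e : Fin n → E)
    (f : Lip0 𝕂 x₀ (StrongDual 𝕂 E)) :
    (∑ i, (a i : 𝕂) • delta 𝕂 x₀ (y i) (y' i) (e i) : Tensor 𝕂 E x₀).1 f =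
      ∑ i, (a i : 𝕂) * (f.1 (y i) - f.1 (y' i)) (e i) := by
  simp [delta_apply, RCLike.real_smul_eq_coe_mul]

theorem sum_delta_apply {n : ℕ} (y y' : Fin n → X) (e : Fin n → E)
    (f : Lip0 𝕂 x₀ (StrongDual 𝕂 E)) :
    (∑ i, delta 𝕂 x₀ (y i) (y' i) (e i) : Tensor 𝕂 E x₀).1 f =
      ∑ i, (f.1 (y i) - f.1 (y' i)) (e i) := by
  simp [delta_apply]

theorem tensor_ext {u v : Tensor 𝕂 E x₀} (h : ∀ f, u.1 f = v.1 f) : u = v :=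
  Subtype.ext (LinearMap.ext h)

theorem smul_delta (c : 𝕂) (x y : X) (e : E) :
    c • delta 𝕂 x₀ x y e = delta 𝕂 x₀ x y (c • e) :=
  tensor_ext fun f => by simp [delta_apply]

theorem delta_add (x y : X) (e e' : E) :
    delta 𝕂 x₀ x y (e + e') = delta 𝕂 x₀ x y e + delta 𝕂 x₀ x y e' :=
  tensor_ext fun f => by simp [delta_apply]; ring

theorem delta_eq_sub (x y : X) (e : E) :
    delta 𝕂 x₀ x y e = delta 𝕂 x₀ x x₀ e - delta 𝕂 x₀ y x₀ e :=
  tensor_ext fun f => by simp [delta_apply]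

theorem exists_eq_sum_delta (u : Tensor 𝕂 E x₀) :
    ∃ (n : ℕ) (x y : Fin n → X) (e : Fin n → E), u = ∑ i, delta 𝕂 x₀ (x i) (y i) (e i) := by
  obtain ⟨u, hu⟩ := u
  induction hu using Submodule.span_induction with
  | mem u hu =>
    obtain ⟨x, y, e, rfl⟩ := hu
    exact ⟨1, fun _ => x, fun _ => y, fun _ => e, by simp; rfl⟩
  | zero => exact ⟨0, Fin.elim0, Fin.elim0, Fin.elim0, by simp; rfl⟩
  | add u v hu hv ihu ihv =>
    obtain ⟨n, x, y, e, h⟩ := ihu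
    obtain ⟨m, x', y', e', h'⟩ := ihv
    refine ⟨n + m, Fin.append x x', Fin.append y y', Fin.append e e', ?_⟩
    rw [Fin.sum_univ_add]
    simp only [Fin.append_left, Fin.append_right]
    rw [← h, ← h']
    rfl
  | smul c u hu ihu =>
    obtain ⟨n, x, y, e, h⟩ := ihu
    refine ⟨n, x, y, fun i => c • e i, ?_⟩
    simp only [← smul_delta]
    rw [← Finset.smul_sum, ← h]
    rfl

theorem Dominated.refl {q : ℝ≥0∞} {n : ℕ} (a : Fin n → ℝ) (y y' : Fin n → X) :
    Dominated 𝕂 x₀ q a y y' a y y' := fun _ _ => le_rfl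

theorem Dominated.smul {q : ℝ≥0∞} [Fact (1 ≤ q)] {n m : ℕ} {a : Fin n → ℝ} {y y' : Fin n → X}
    {b : Fin m → ℝ} {x x' : Fin m → X} (h : Dominated 𝕂 x₀ q a y y' b x x') (t : ℝ) :
    Dominated 𝕂 x₀ q (fun i => t * a i) y y' (fun j => t * b j) x x' := by
  intro g hg
  have h1 := norm_toLp_const_smul (q := q) (t : 𝕂) (fun i => (a i : 𝕂) * (g (y i) - g (y' i)))
  have h2 := norm_toLp_const_smul (q := q) (t : 𝕂) (fun j => (b j : 𝕂) * (g (x j) - g (x' j)))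
  simp only [smul_eq_mul, ← mul_assoc, ← RCLike.ofReal_mul] at h1 h2
  rw [h1, h2]
  exact mul_le_mul_of_nonneg_left (h g hg) (norm_nonneg _)

theorem Dominated.append {q : ℝ≥0∞} [Fact (1 ≤ q)] {n m n₁ m₁ : ℕ}
    {a : Fin n → ℝ} {y y' : Fin n → X} {b : Fin m → ℝ} {x x' : Fin m → X}
    {a₁ : Fin n₁ → ℝ} {y₁ y₁' : Fin n₁ → X} {b₁ : Fin m₁ → ℝ} {x₁ x₁' : Fin m₁ → X}
    (h : Dominated 𝕂 x₀ q a y y' b x x') (h₁ : Dominated 𝕂 x₀ q a₁ y₁ y₁' b₁ x₁ x₁') :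
    Dominated 𝕂 x₀ q (Fin.append a a₁) (Fin.append y y₁) (Fin.append y' y₁')
      (Fin.append b b₁) (Fin.append x x₁) (Fin.append x' x₁') := by
  intro g hg
  have key : ∀ {n m : ℕ} (a : Fin n → ℝ) (a₁ : Fin m → ℝ) (y y' : Fin n → X) (y₁ y₁' : Fin m → X),
      (fun i => ((Fin.append a a₁ i : ℝ) : 𝕂) * (g (Fin.append y y₁ i) - g (Fin.append y' y₁' i))) =
      Fin.append (fun i => (a i : 𝕂) * (g (y i) - g (y' i)))
        (fun i => (a₁ i : 𝕂) * (g (y₁ i) - g (y₁' i))) := by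
    intro n m a a₁ y y' y₁ y₁'
    funext i
    refine Fin.addCases (fun i => ?_) (fun i => ?_) i <;> simp
  rw [key, key]
  exact norm_toLp_append_mono (h g hg) (h₁ g hg)

theorem exists_of_wNorm_lt (p : ℝ≥0∞) {u : Tensor 𝕂 E x₀} {c : ℝ} (h : wNorm p u < c) :
    ∃ (n m : ℕ) (a : Fin n → ℝ) (y y' : Fin n → X) (e : Fin n → E)
    (b : Fin m → ℝ) (x x' : Fin m → X),
    u = ∑ i, (a i : 𝕂) • delta 𝕂 x₀ (y i) (y' i) (e i) ∧
    Dominated 𝕂 x₀ p.conjExponent a y y' b x x' ∧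
    ‖WithLp.toLp p e‖ * ‖WithLp.toLp p.conjExponent (fun j => b j * dist (x j) (x' j))‖ < c := by
  obtain ⟨_, ⟨n, m, a, y, y', e, b, x, x', hu, hd, rfl⟩, hc⟩ := exists_lt_of_csInf_lt (by
    obtain ⟨n, x, y, e, hu⟩ := exists_eq_sum_delta u
    exact ⟨_, n, n, fun _ => 1, x, y, e, fun _ => 1, x, y, by simpa using hu,
      Dominated.refl _ _ _, rfl⟩) h
  exact ⟨n, m, a, y, y', e, b, x, x', hu, hd, hc⟩

/-- To bound a quantity by a multiple of `wNorm p u`, it suffices to do so for each admissible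
representation of `u`. -/
theorem le_mul_wNorm (p : ℝ≥0∞) {u : Tensor 𝕂 E x₀} {r K : ℝ} (hK : 0 ≤ K)
    (h : ∀ (n m : ℕ) (a : Fin n → ℝ) (y y' : Fin n → X) (e : Fin n → E)
      (b : Fin m → ℝ) (x x' : Fin m → X),
      u = ∑ i, (a i : 𝕂) • delta 𝕂 x₀ (y i) (y' i) (e i) →
      Dominated 𝕂 x₀ p.conjExponent a y y' b x x' →
      r ≤ K * (‖WithLp.toLp p e‖ *
        ‖WithLp.toLp p.conjExponent (fun j => b j * dist (x j) (x' j))‖)) :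
    r ≤ K * wNorm p u := by
  have key : ∀ ε > 0, r ≤ K * (wNorm p u + ε) := by
    intro ε hε
    obtain ⟨n, m, a, y, y', e, b, x, x', hu, hd, hc⟩ := exists_of_wNorm_lt p
      (lt_add_of_pos_right (wNorm p u) hε)
    exact (h n m a y y' e b x x' hu hd).trans (mul_le_mul_of_nonneg_left hc.le hK)
  refine le_of_forall_pos_le_add fun ε hε => ?_
  refine (key (ε / (K + 1)) (by positivity)).trans ?_
  rw [mul_add]
  gcongr
  rw [mul_div_assoc', div_le_iff₀ (by positivity)]
  nlinarith

variable (p : ℝ≥0∞) [Fact (1 ≤ p)]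

theorem wNorm_le_of_eq {u : Tensor 𝕂 E x₀} {n m : ℕ} {a : Fin n → ℝ} {y y' : Fin n → X}
    {e : Fin n → E} {b : Fin m → ℝ} {x x' : Fin m → X}
    (hu : u = ∑ i, (a i : 𝕂) • delta 𝕂 x₀ (y i) (y' i) (e i))
    (hd : Dominated 𝕂 x₀ p.conjExponent a y y' b x x') :
    wNorm p u ≤ ‖WithLp.toLp p e‖ *
      ‖WithLp.toLp p.conjExponent (fun j => b j * dist (x j) (x' j))‖ := by
  refine csInf_le ⟨0, ?_⟩ ⟨n, m, a, y, y', e, b, x, x', hu, hd, rfl⟩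
  rintro _ ⟨n, m, a, y, y', e, b, x, x', -, -, rfl⟩
  positivity

theorem wNorm_nonneg (u : Tensor 𝕂 E x₀) : 0 ≤ wNorm p u := by
  apply Real.sInf_nonneg
  rintro _ ⟨n, m, a, y, y', e, b, x, x', -, -, rfl⟩
  positivity

theorem exists_pos_mul_le {A B α β : ℝ} (hA : 0 ≤ A) (hB : 0 ≤ B) (hα : 0 < α) (hβ : 0 < β)
    (h : A * B ≤ α * β) : ∃ t : ℝ, 0 < t ∧ t * A ≤ α ∧ t⁻¹ * B ≤ β := by
  obtain rfl | hA' := hA.eq_or_lt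
  · refine ⟨B / β + 1, by positivity, by simpa using hα.le, ?_⟩
    rw [inv_mul_le_iff₀ (by positivity), add_mul, div_mul_cancel₀ _ hβ.ne']
    linarith
  · refine ⟨α / A, by positivity, by rw [div_mul_cancel₀ _ hA'.ne'], ?_⟩
    rw [inv_mul_le_iff₀ (by positivity), div_mul_eq_mul_div, le_div_iff₀ hA']
    linarith

/-- A representation may be rescaled by `t` on the vectors and `t⁻¹` on both families of scalars.
This splits the cost `c` as `c^(1/p) * c^(1/p')`, the form in which costs add under concatenation;
it gives the triangle inequality. -/
theorem exists_balanced_of_wNorm_lt {u : Tensor 𝕂 E x₀} {c : ℝ} (h : wNorm p u < c) :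
    ∃ (n m : ℕ) (a : Fin n → ℝ) (y y' : Fin n → X) (e : Fin n → E)
    (b : Fin m → ℝ) (x x' : Fin m → X),
    u = ∑ i, (a i : 𝕂) • delta 𝕂 x₀ (y i) (y' i) (e i) ∧
    Dominated 𝕂 x₀ p.conjExponent a y y' b x x' ∧
    ‖WithLp.toLp p e‖ ≤ c ^ p.toReal⁻¹ ∧
    ‖WithLp.toLp p.conjExponent (fun j => b j * dist (x j) (x' j))‖ ≤
      c ^ p.conjExponent.toReal⁻¹ := by
  have hc : 0 < c := (wNorm_nonneg p u).trans_lt h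
  obtain ⟨n, m, a, y, y', e, b, x, x', hu, hd, hlt⟩ := exists_of_wNorm_lt p h
  obtain ⟨t, ht, h1, h2⟩ := exists_pos_mul_le (norm_nonneg (WithLp.toLp p e))
    (norm_nonneg (WithLp.toLp p.conjExponent (fun j => b j * dist (x j) (x' j))))
    (Real.rpow_pos_of_pos hc p.toReal⁻¹) (Real.rpow_pos_of_pos hc p.conjExponent.toReal⁻¹) (by
      rw [← Real.rpow_add hc, inv_toReal_add_inv_toReal inferInstance, Real.rpow_one]
      exact hlt.le)
  refine ⟨n, m, fun i => t⁻¹ * a i, y, y', fun i => (t : 𝕂) • e i, fun j => t⁻¹ * b j, x, x', ?_,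
    hd.smul _, ?_, ?_⟩
  · rw [hu]
    refine Finset.sum_congr rfl fun i _ => ?_
    rw [← smul_delta, smul_smul]
    congr 1
    have : (t : 𝕂) ≠ 0 := by exact_mod_cast ht.ne'
    push_cast
    field_simp
  · rw [norm_toLp_const_smul, RCLike.norm_ofReal, abs_of_pos ht]
    exact h1
  · have := norm_toLp_const_smul (q := p.conjExponent) t⁻¹ (fun j => b j * dist (x j) (x' j))
    simp only [smul_eq_mul, ← mul_assoc] at this
    rw [this, Real.norm_of_nonneg (by positivity)]
    exact h2

theorem wNorm_add_le (u v : Tensor 𝕂 E x₀) : wNorm p (u + v) ≤ wNorm p u + wNorm p v := by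
  refine le_of_forall_pos_le_add fun ε hε => ?_
  have hcu : wNorm p u < wNorm p u + ε / 2 := by linarith
  have hcv : wNorm p v < wNorm p v + ε / 2 := by linarith
  have hu0 := wNorm_nonneg p u
  have hv0 := wNorm_nonneg p v
  obtain ⟨n, m, a, y, y', e, b, x, x', hu, hd, h1, h2⟩ := exists_balanced_of_wNorm_lt p hcu
  obtain ⟨n₁, m₁, a₁, y₁, y₁', e₁, b₁, x₁, x₁', hu₁, hd₁, h3, h4⟩ :=
    exists_balanced_of_wNorm_lt p hcv
  set c := wNorm p u + ε / 2
  set d := wNorm p v + ε / 2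
  have hc : 0 < c := hu0.trans_lt hcu
  have hd0 : 0 < d := hv0.trans_lt hcv
  have key : (fun j => Fin.append b b₁ j * dist (Fin.append x x₁ j) (Fin.append x' x₁' j)) =
      Fin.append (fun j => b j * dist (x j) (x' j)) (fun j => b₁ j * dist (x₁ j) (x₁' j)) := by
    funext i
    refine Fin.addCases (fun i => ?_) (fun i => ?_) i <;> simp
  have hrep : u + v = ∑ i, ((Fin.append a a₁ i : ℝ) : 𝕂) •
      delta 𝕂 x₀ (Fin.append y y₁ i) (Fin.append y' y₁' i) (Fin.append e e₁ i) := by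
    rw [Fin.sum_univ_add, hu, hu₁]
    simp
  refine (wNorm_le_of_eq p hrep (hd.append hd₁)).trans ?_
  rw [key]
  calc _ ≤ (c + d) ^ p.toReal⁻¹ * (c + d) ^ p.conjExponent.toReal⁻¹ :=
        mul_le_mul (norm_toLp_append_le hc.le hd0.le h1 h3)
          (norm_toLp_append_le hc.le hd0.le h2 h4) (norm_nonneg _) (by positivity)
    _ = c + d := by
      rw [← Real.rpow_add (by positivity), inv_toReal_add_inv_toReal inferInstance, Real.rpow_one]
    _ = wNorm p u + wNorm p v + ε := by ring

theorem wNorm_smul_le (c : 𝕂) (u : Tensor 𝕂 E x₀) : wNorm p (c • u) ≤ ‖c‖ * wNorm p u := by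
  refine le_mul_wNorm p (norm_nonneg c) fun n m a y y' e b x x' hu hd => ?_
  have hrep : c • u = ∑ i, (a i : 𝕂) • delta 𝕂 x₀ (y i) (y' i) (c • e i) := by
    rw [hu, Finset.smul_sum]
    exact Finset.sum_congr rfl fun i _ => by rw [← smul_delta, smul_comm]
  refine (wNorm_le_of_eq p hrep hd).trans_eq ?_
  rw [norm_toLp_const_smul, mul_assoc]

theorem wNorm_smul (c : 𝕂) (u : Tensor 𝕂 E x₀) : wNorm p (c • u) = ‖c‖ * wNorm p u := by
  obtain rfl | hc := eq_or_ne c 0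
  · refine le_antisymm (wNorm_smul_le p 0 u) ?_
    rw [norm_zero, zero_mul]
    exact wNorm_nonneg p _
  · refine le_antisymm (wNorm_smul_le p c u) ?_
    have h := wNorm_smul_le p c⁻¹ (c • u)
    rw [inv_smul_smul₀ hc, norm_inv] at h
    rwa [le_inv_mul_iff₀ (norm_pos_iff.2 hc)] at h

/-- The rank one map `x ↦ g x • v`. -/
def rankOne (g : Lip0 𝕂 x₀ 𝕂) (v : StrongDual 𝕂 E) : Lip0 𝕂 x₀ (StrongDual 𝕂 E) :=
  ⟨fun x => g.1 x • v, (congrArg (· • v) g.2.1).trans (zero_smul 𝕂 v), by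
    obtain ⟨C, hC⟩ := g.2.2
    refine ⟨C * ‖v‖₊, LipschitzWith.of_dist_le_mul fun x y => ?_⟩
    have h : g.1 x • v - g.1 y • v = (g.1 x - g.1 y) • v := (sub_smul _ _ _).symm
    rw [dist_eq_norm, h, norm_smul, ← dist_eq_norm]
    calc dist (g.1 x) (g.1 y) * ‖v‖ ≤ (C * dist x y) * ‖v‖ := by
          gcongr; exact hC.dist_le_mul x y
      _ = _ := by push_cast; ring⟩

theorem rankOne_sub_apply (g : Lip0 𝕂 x₀ 𝕂) (v : StrongDual 𝕂 E) (x y : X) (e : E) :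
    ((rankOne g v).1 x - (rankOne g v).1 y) e = (g.1 x - g.1 y) * v e := by
  simp [rankOne, sub_mul]

/-- Hölder separates the `e i` from the increments of `g`, and domination passes to the increments
on the `x j`, which are at most `K * dist`. Both definiteness and the lower cross-norm estimate rest
on this. -/
theorem norm_apply_rankOne_le (u : Tensor 𝕂 E x₀) (g : Lip0 𝕂 x₀ 𝕂) {K : ℝ≥0}
    (hK : LipschitzWith K g.1) (v : StrongDual 𝕂 E) :
    ‖u.1 (rankOne g v)‖ ≤ (K * ‖v‖) * wNorm p u := by
  refine le_mul_wNorm p (by positivity) fun n m a y y' e b x x' hu hd => ?_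
  rw [hu, sum_smul_delta_apply]
  set s : Fin n → 𝕂 := fun i => (a i : 𝕂) * (g.1 (y i) - g.1 (y' i)) with hs
  calc ‖∑ i, (a i : 𝕂) * ((rankOne g v).1 (y i) - (rankOne g v).1 (y' i)) (e i)‖
      ≤ ∑ i, ‖v‖ * (‖e i‖ * ‖s i‖) := by
        refine norm_sum_le_of_le _ fun i _ => ?_
        have : (a i : 𝕂) * ((rankOne g v).1 (y i) - (rankOne g v).1 (y' i)) (e i) =
            s i * v (e i) := by
          rw [rankOne_sub_apply, hs]
          ring
        rw [this, norm_mul]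
        nlinarith [v.le_opNorm (e i), norm_nonneg (s i)]
    _ ≤ ‖v‖ * (‖WithLp.toLp p e‖ * ‖WithLp.toLp p.conjExponent s‖) := by
        rw [← Finset.mul_sum]
        exact mul_le_mul_of_nonneg_left (sum_norm_mul_norm_le inferInstance _ _) (norm_nonneg _)
    _ ≤ ‖v‖ * (‖WithLp.toLp p e‖ *
          (K * ‖WithLp.toLp p.conjExponent (fun j => b j * dist (x j) (x' j))‖)) := by
        gcongr
        refine (hd g.1 g.2).trans (norm_toLp_mul_le K.2 fun j => ?_)
        rw [norm_mul, RCLike.norm_ofReal, abs_mul, abs_of_nonneg dist_nonneg, ← dist_eq_norm]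
        calc |b j| * dist (g.1 (x j)) (g.1 (x' j)) ≤ |b j| * (K * dist (x j) (x' j)) := by
              gcongr; exact hK.dist_le_mul _ _
          _ = _ := by ring
    _ = _ := by ring

/-- The distance to the other points of `P`, normalized at `z`. These bumps interpolate arbitrary
data on a finite set by Lipschitz functions. -/
theorem exists_lipschitz_bump (P : Finset X) (z : X) :
    ∃ b : X → ℝ, (∃ C : ℝ≥0, LipschitzWith C b) ∧ b z = 1 ∧ ∀ z' ∈ P, z' ≠ z → b z' = 0 := by
  classical
  obtain h | h := (P.erase z).eq_empty_or_nonempty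
  · refine ⟨fun _ => 1, ⟨0, LipschitzWith.const 1⟩, rfl, fun z' hz' hne => ?_⟩
    simpa [h] using Finset.mem_erase.2 ⟨hne, hz'⟩
  · set S : Set X := ((P.erase z : Finset X) : Set X) with hS
    have hpos : 0 < Metric.infDist z S := by
      refine ((Finset.finite_toSet _).isClosed.notMem_iff_infDist_pos (by exact_mod_cast h)).1 ?_
      simp
    refine ⟨fun x => (Metric.infDist z S)⁻¹ • Metric.infDist x S,
      ⟨_, (lipschitzWith_smul _).comp (Metric.lipschitz_infDist_pt S)⟩, ?_, fun z' hz' hne => ?_⟩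
    · simp [hpos.ne']
    · have : Metric.infDist z' S = 0 :=
        Metric.infDist_zero_of_mem (by simp [hS, hne, hz'])
      simp [this]

theorem exists_lipschitz_bump_rclike (𝕂 : Type k) [RCLike 𝕂] (P : Finset X) (z : X) :
    ∃ b : X → 𝕂, (∃ C : ℝ≥0, LipschitzWith C b) ∧ b z = 1 ∧ ∀ z' ∈ P, z' ≠ z → b z' = 0 := by
  obtain ⟨b, ⟨C, hC⟩, h1, h2⟩ := exists_lipschitz_bump P z
  refine ⟨fun x => (b x : 𝕂), ⟨C, LipschitzWith.of_dist_le_mul fun x y => ?_⟩, by simp [h1],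
    fun z' hz' hne => by simp [h2 z' hz' hne]⟩
  rw [dist_eq_norm, ← RCLike.ofReal_sub, RCLike.norm_ofReal]
  exact hC.dist_le_mul x y

theorem exists_lip0_eqOn (𝕂 : Type k) [RCLike 𝕂] (x₀ : X) (P : Finset X) (hP : x₀ ∈ P) (v : X → 𝕂) :
    ∃ g ∈ Lip0 𝕂 x₀ 𝕂, ∀ z ∈ P, g z = v z - v x₀ := by
  choose b hb hb1 hb0 using fun z => exists_lipschitz_bump_rclike 𝕂 P z
  refine ⟨∑ z ∈ P, (v z - v x₀) • b z, Submodule.sum_mem _ fun z hz => ?_, fun z hz => ?_⟩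
  · obtain rfl | hne := eq_or_ne x₀ z
    · rw [sub_self, zero_smul]
      exact Submodule.zero_mem _
    · exact Submodule.smul_mem _ _ ⟨hb0 z x₀ hP hne, hb z⟩
  · rw [Finset.sum_apply, Finset.sum_eq_single z]
    · simp [hb1]
    · intro z' _ hne
      simp [hb0 z' z hz hne.symm]
    · exact fun h => (h hz).elim

/-- A tensor sees only finitely many points, and there every `f` agrees with a finite sum of rank
one maps, on each of which `u` vanishes. -/
theorem eq_zero_of_wNorm_eq_zero {u : Tensor 𝕂 E x₀} (hu : wNorm p u = 0) : u = 0 := by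
  classical
  refine tensor_ext fun f => ?_
  obtain ⟨n, x, y, e, rfl⟩ := exists_eq_sum_delta u
  set P : Finset X := insert x₀ (Finset.univ.image x ∪ Finset.univ.image y) with hP
  have hx : ∀ i, x i ∈ P := fun i => by simp [hP]
  have hy : ∀ i, y i ∈ P := fun i => by simp [hP]
  choose b hb hb1 hb0 using fun z => exists_lipschitz_bump_rclike 𝕂 P z
  have hmem : ∀ z ∈ P.erase x₀, b z ∈ Lip0 𝕂 x₀ 𝕂 := fun z hz =>
    ⟨hb0 z x₀ (by simp [hP]) (Finset.ne_of_mem_erase hz).symm, hb z⟩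
  have hval : ∀ z ∈ P, f.1 z = ∑ z' ∈ (P.erase x₀).attach, b z' z • f.1 z' := by
    intro z hz
    rw [Finset.sum_attach (P.erase x₀) fun z' => b z' z • f.1 z']
    by_cases hz0 : z = x₀
    · subst hz0
      rw [f.2.1, Finset.sum_eq_zero]
      intro z' hz'
      rw [hb0 z' z hz (Finset.ne_of_mem_erase hz').symm]
      exact zero_smul 𝕂 (f.1 z')
    · rw [Finset.sum_eq_single z]
      · rw [hb1]
        exact (one_smul 𝕂 (f.1 z)).symm
      · intro z' _ hne
        rw [hb0 z' z hz hne.symm]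
        exact zero_smul 𝕂 (f.1 z')
      · exact fun h => (h (Finset.mem_erase.2 ⟨hz0, hz⟩)).elim
  set u : Tensor 𝕂 E x₀ := ∑ i, delta 𝕂 x₀ (x i) (y i) (e i) with hudef
  have hzero : ∀ z : {z // z ∈ P.erase x₀}, u.1 (rankOne ⟨b z, hmem z z.2⟩ (f.1 z)) = 0 := by
    intro z
    obtain ⟨K, hK⟩ := hb z
    have := norm_apply_rankOne_le p u ⟨b z, hmem z z.2⟩ hK (f.1 z)
    rw [hu, mul_zero] at this
    exact norm_le_zero_iff.1 this
  have : u.1 f = u.1 (∑ z ∈ (P.erase x₀).attach, rankOne ⟨b z, hmem z z.2⟩ (f.1 z)) := by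
    rw [hudef, sum_delta_apply, sum_delta_apply]
    refine Finset.sum_congr rfl fun i _ => ?_
    rw [hval _ (hx i), hval _ (hy i)]
    simp [rankOne]
  rw [this, map_sum, Finset.sum_eq_zero fun z _ => hzero z]
  rfl

theorem wNorm_delta (x y : X) (e : E) : wNorm p (delta 𝕂 x₀ x y e) = dist x y * ‖e‖ := by
  apply le_antisymm
  · refine (wNorm_le_of_eq p (n := 1) (m := 1) (a := fun _ => 1) (y := fun _ => x)
      (y' := fun _ => y) (e := fun _ => e) (b := fun _ => 1) (x := fun _ => x) (x' := fun _ => y)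
      (by simp) (Dominated.refl _ _ _)).trans ?_
    rw [mul_comm]
    simp only [one_mul]
    have h1 := PiLp.norm_toLp_const' (p := p) (ι := Fin 1) e
    have h2 := PiLp.norm_toLp_const' (p := p.conjExponent) (ι := Fin 1) (dist x y)
    rw [Fintype.card_fin, Nat.cast_one, NNReal.coe_one, Real.one_rpow, one_mul] at h1 h2
    exact (congrArg₂ (· * ·) (h2.trans (by simp : ‖dist x y‖ = dist x y)) h1).le
  · obtain ⟨v, hv1, hv2⟩ := exists_dual_vector'' 𝕂 e
    -- The 1-Lipschitz function `dist · y`, shifted to vanish at `x₀`, paired with a norming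
    -- functional of `e`, attains `dist x y * ‖e‖`.
    set g : X → 𝕂 := fun z => ((dist z y - dist x₀ y : ℝ) : 𝕂) with hg
    have hL : LipschitzWith 1 g := LipschitzWith.of_dist_le_mul fun z z' => by
      rw [dist_eq_norm, ← RCLike.ofReal_sub, RCLike.norm_ofReal]
      simpa using abs_dist_sub_le z z' y
    have := norm_apply_rankOne_le p (delta 𝕂 x₀ x y e) ⟨g, by simp [hg], 1, hL⟩ hL v
    rw [delta_apply, rankOne_sub_apply, hv2] at this
    simp only [hg, ← RCLike.ofReal_sub, norm_mul, RCLike.norm_ofReal, dist_self, sub_sub_sub_cancel_right,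
      sub_zero, abs_dist, abs_norm] at this
    refine this.trans (mul_le_of_le_one_left (wNorm_nonneg p _) ?_)
    simpa using hv1

theorem isLipschitzCrossNorm_wNorm :
    IsLipschitzCrossNorm (wNorm p : Tensor 𝕂 E x₀ → ℝ) where
  add_le := wNorm_add_le p
  smul_eq := wNorm_smul p
  eq_zero _ := eq_zero_of_wNorm_eq_zero p
  cross := wNorm_delta p

end TensorNorm

/-! ### The `α`-Lipschitz maps as the dual of the completed tensor product -/

section Duality

variable {𝕂 : Type k} [RCLike 𝕂] {X : Type u} [MetricSpace X]
  {E : Type v} [NormedAddCommGroup E] [NormedSpace 𝕂 E] {x₀ : X} {α : Tensor 𝕂 E x₀ → ℝ}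

theorem AlphaBound.norm_sub_le (h : IsLipschitzCrossNorm α) {f : X → StrongDual 𝕂 E} {C : ℝ}
    (hC : 0 ≤ C) (hf : AlphaBound α f C) (x y : X) : ‖f x - f y‖ ≤ C * dist x y := by
  refine ContinuousLinearMap.opNorm_le_bound _ (by positivity) fun e => ?_
  have := hf 1 (fun _ => x) (fun _ => y) (fun _ => e)
  simpa [h.cross, mul_assoc] using this

theorem alphaLip_subset_lip0 (h : IsLipschitzCrossNorm α) {f : X → StrongDual 𝕂 E}
    (hf : f ∈ alphaLip α) : f ∈ Lip0 𝕂 x₀ (StrongDual 𝕂 E) := by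
  obtain ⟨h0, C, hC, hb⟩ := hf
  refine ⟨h0, ⟨C, hC⟩, LipschitzWith.of_dist_le_mul fun x y => ?_⟩
  rw [dist_eq_norm]
  exact hb.norm_sub_le h hC x y

/-- Scalars can be absorbed into the vectors `e`, so coefficient-free sums of elementary tensors
already exhaust `X ⊠ E`. -/
theorem alphaBound_iff {f : Lip0 𝕂 x₀ (StrongDual 𝕂 E)} {C : ℝ} :
    AlphaBound α f.1 C ↔ ∀ u : Tensor 𝕂 E x₀, ‖u.1 f‖ ≤ C * α u := by
  constructor
  · intro h u
    obtain ⟨n, x, y, e, rfl⟩ := exists_eq_sum_delta u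
    rw [sum_delta_apply]
    exact h n x y e
  · intro h n x y e
    rw [← sum_delta_apply]
    exact h _

theorem zero_mem_alphaLip : (0 : X → StrongDual 𝕂 E) ∈ alphaLip α := by
  refine ⟨rfl, 0, le_rfl, (alphaBound_iff (f := 0)).2 fun u => ?_⟩
  rw [map_zero, norm_zero, zero_mul]

theorem AlphaBound.add {f g : X → StrongDual 𝕂 E} {C D : ℝ} (hf : AlphaBound α f C)
    (hg : AlphaBound α g D) : AlphaBound α (f + g) (C + D) := by
  intro n x y e
  have key : ∀ i, ((f + g) (x i) - (f + g) (y i)) (e i) =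
      (f (x i) - f (y i)) (e i) + (g (x i) - g (y i)) (e i) := fun i => by
    simp only [Pi.add_apply, sub_apply, add_apply]
    ring
  simp only [key, Finset.sum_add_distrib, add_mul]
  exact (norm_add_le _ _).trans (add_le_add (hf n x y e) (hg n x y e))

theorem AlphaBound.smul (c : 𝕂) {f : X → StrongDual 𝕂 E} {C : ℝ} (hf : AlphaBound α f C) :
    AlphaBound α (c • f) (‖c‖ * C) := by
  intro n x y e
  have key : ∀ i, ((c • f) (x i) - (c • f) (y i)) (e i) = c * (f (x i) - f (y i)) (e i) :=
    fun i => by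
      simp only [Pi.smul_apply, sub_apply, smul_apply, smul_eq_mul]
      ring
  simp only [key, ← Finset.mul_sum, norm_mul, mul_assoc]
  exact mul_le_mul_of_nonneg_left (hf n x y e) (norm_nonneg c)

/-- The linear space of `α`-Lipschitz operators. -/
def alphaLipSubmodule (_h : IsLipschitzCrossNorm α) : Submodule 𝕂 (X → StrongDual 𝕂 E) where
  carrier := alphaLip α
  zero_mem' := zero_mem_alphaLip
  add_mem' := by
    rintro f g ⟨hf, C, hC, hfC⟩ ⟨hg, D, hD, hgD⟩
    exact ⟨by rw [Pi.add_apply, hf, hg, add_zero], C + D, add_nonneg hC hD, hfC.add hgD⟩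
  smul_mem' := by
    rintro c f ⟨hf, C, hC, hfC⟩
    exact ⟨(congrArg (c • ·) hf).trans (smul_zero (A := StrongDual 𝕂 E) c), ‖c‖ * C, by positivity, hfC.smul c⟩

/-- An `α`-Lipschitz operator as an element of `Lip₀(X, E*)`. -/
def alphaLipInclusion (h : IsLipschitzCrossNorm α) :
    alphaLipSubmodule h →ₗ[𝕂] Lip0 𝕂 x₀ (StrongDual 𝕂 E) where
  toFun f := ⟨f.1, alphaLip_subset_lip0 h f.2⟩
  map_add' _ _ := rfl
  map_smul' _ _ := rfl

/-- Evaluation of the elements of `X ⊠_α E` at an `α`-Lipschitz operator. -/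
noncomputable def evalTensor (h : IsLipschitzCrossNorm α) (f : alphaLipSubmodule h) :
    NormedTensor h →ₗ[𝕂] 𝕂 where
  toFun u := Subtype.val (show Tensor 𝕂 E x₀ from u) (alphaLipInclusion h f)
  map_add' _ _ := rfl
  map_smul' _ _ := rfl

theorem evalTensor_bound (h : IsLipschitzCrossNorm α) (f : alphaLipSubmodule h) {C : ℝ} :
    AlphaBound α f.1 C ↔ ∀ u : NormedTensor h, ‖evalTensor h f u‖ ≤ C * ‖u‖ :=
  alphaBound_iff (f := alphaLipInclusion h f)

theorem completedTensor_dual_ext (h : IsLipschitzCrossNorm α)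
    {Φ Ψ : StrongDual 𝕂 (CompletedTensor h)}
    (hΦ : ∀ u : NormedTensor h, Φ (u : CompletedTensor h) = Ψ (u : CompletedTensor h)) : Φ = Ψ := by
  ext z
  induction z using UniformSpace.Completion.induction_on with
  | hp => exact isClosed_eq Φ.continuous Ψ.continuous
  | ih u => exact hΦ u

/-- The functional on `X ⊠̂_α E` induced by an `α`-Lipschitz operator. -/
noncomputable def dualFunctional (h : IsLipschitzCrossNorm α) (f : alphaLipSubmodule h) :
    StrongDual 𝕂 (CompletedTensor h) :=
  (evalTensor h f).extendOfNorm
    (UniformSpace.Completion.toComplL (𝕜 := 𝕂) (E := NormedTensor h)).toLinearMap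

theorem dualFunctional_coe (h : IsLipschitzCrossNorm α) (f : alphaLipSubmodule h)
    (u : NormedTensor h) : dualFunctional h f (u : CompletedTensor h) = evalTensor h f u := by
  obtain ⟨-, C, hC, hb⟩ := f.2
  refine LinearMap.extendOfNorm_eq (UniformSpace.Completion.denseRange_coe) ⟨C, fun u => ?_⟩ u
  have := (evalTensor_bound h f).1 hb u
  rwa [← UniformSpace.Completion.norm_coe u] at this

theorem norm_dualFunctional (h : IsLipschitzCrossNorm α) (f : alphaLipSubmodule h) :
    ‖dualFunctional h f‖ = alphaLipNorm α f.1 := by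
  rw [ContinuousLinearMap.norm_def, alphaLipNorm]
  congr 1
  ext C
  refine and_congr_right fun hC => ?_
  rw [evalTensor_bound]
  constructor
  · intro hb u
    rw [← dualFunctional_coe, ← UniformSpace.Completion.norm_coe u]
    exact hb _
  · intro hb z
    induction z using UniformSpace.Completion.induction_on with
    | hp => exact isClosed_le (by fun_prop) (by fun_prop)
    | ih u =>
      rw [dualFunctional_coe, UniformSpace.Completion.norm_coe u]
      exact hb u

/-- The restriction to `X ⊠ E` of a functional on the completion. -/
noncomputable def restrictTensor (h : IsLipschitzCrossNorm α) (Φ : StrongDual 𝕂 (CompletedTensor h)) :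
    Tensor 𝕂 E x₀ →ₗ[𝕂] 𝕂 where
  toFun u := Φ ((show NormedTensor h from u : NormedTensor h) : CompletedTensor h)
  map_add' u v := (congrArg Φ (UniformSpace.Completion.coe_add (α := NormedTensor h) u v)).trans
    (map_add Φ _ _)
  map_smul' c u := (congrArg Φ (UniformSpace.Completion.coe_smul (X := NormedTensor h) c u)).trans
    (map_smul Φ c _)

theorem norm_restrictTensor_le (h : IsLipschitzCrossNorm α)
    (Φ : StrongDual 𝕂 (CompletedTensor h)) (u : Tensor 𝕂 E x₀) :
    ‖restrictTensor h Φ u‖ ≤ ‖Φ‖ * α u :=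
  (Φ.le_opNorm _).trans_eq
    (congrArg (‖Φ‖ * ·) (UniformSpace.Completion.norm_coe (E := NormedTensor h) u))

/-- The linear functional on `E` induced by a functional on the completion and a point of `X`. -/
noncomputable def linearOfDual (h : IsLipschitzCrossNorm α)
    (Φ : StrongDual 𝕂 (CompletedTensor h)) (x : X) : E →ₗ[𝕂] 𝕂 where
  toFun e := restrictTensor h Φ (delta 𝕂 x₀ x x₀ e)
  map_add' e e' := (congrArg _ (delta_add x x₀ e e')).trans (map_add _ _ _)
  map_smul' c e := (congrArg _ (smul_delta c x x₀ e).symm).trans (map_smul _ _ _)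

/-- The map `X → E*` induced by a functional on the completion. -/
noncomputable def operatorOfDual (h : IsLipschitzCrossNorm α)
    (Φ : StrongDual 𝕂 (CompletedTensor h)) (x : X) : StrongDual 𝕂 E :=
  (linearOfDual h Φ x).mkContinuous (‖Φ‖ * dist x x₀) fun e =>
    (norm_restrictTensor_le h Φ (delta 𝕂 x₀ x x₀ e)).trans_eq (by rw [h.cross, mul_assoc])

theorem operatorOfDual_sub (h : IsLipschitzCrossNorm α) (Φ : StrongDual 𝕂 (CompletedTensor h))
    (x y : X) (e : E) : (operatorOfDual h Φ x - operatorOfDual h Φ y) e =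
      restrictTensor h Φ (delta 𝕂 x₀ x y e) := by
  exact ((congrArg _ (delta_eq_sub x y e)).trans (map_sub (restrictTensor h Φ) _ _)).symm

theorem operatorOfDual_mem (h : IsLipschitzCrossNorm α) (Φ : StrongDual 𝕂 (CompletedTensor h)) :
    operatorOfDual h Φ ∈ alphaLip α := by
  refine ⟨?_, ‖Φ‖, norm_nonneg _, fun n x y e => ?_⟩
  · ext e
    have h1 : delta 𝕂 x₀ x₀ x₀ e = 0 := tensor_ext fun f => by simp [delta_apply]
    exact (congrArg (restrictTensor h Φ) h1).trans (map_zero _)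
  · simp only [operatorOfDual_sub, ← map_sum]
    exact norm_restrictTensor_le h Φ _

theorem dualFunctional_operatorOfDual (h : IsLipschitzCrossNorm α)
    (Φ : StrongDual 𝕂 (CompletedTensor h)) :
    dualFunctional h ⟨operatorOfDual h Φ, operatorOfDual_mem h Φ⟩ = Φ := by
  refine completedTensor_dual_ext h fun u => ?_
  rw [dualFunctional_coe]
  obtain ⟨n, x, y, e, hu⟩ := exists_eq_sum_delta (show Tensor 𝕂 E x₀ from u)
  have h1 : evalTensor h ⟨operatorOfDual h Φ, operatorOfDual_mem h Φ⟩ u =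
      ∑ i, (operatorOfDual h Φ (x i) - operatorOfDual h Φ (y i)) (e i) := by
    subst hu
    exact sum_delta_apply x y e _
  have h2 : restrictTensor h Φ u =
      ∑ i, restrictTensor h Φ (delta 𝕂 x₀ (x i) (y i) (e i)) := by
    rw [← map_sum]
    exact congrArg _ hu
  refine h1.trans (Eq.trans ?_ h2.symm)
  exact Finset.sum_congr rfl fun i _ => operatorOfDual_sub h Φ _ _ _

/-- The space of `α`-Lipschitz operators is the dual of `X ⊠̂_α E`. -/
noncomputable def alphaLipDualEquiv (h : IsLipschitzCrossNorm α) :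
    alphaLipSubmodule h ≃ₗ[𝕂] StrongDual 𝕂 (CompletedTensor h) :=
  LinearEquiv.ofBijective
    { toFun := dualFunctional h
      map_add' := fun f g => completedTensor_dual_ext h fun u => by
        rw [add_apply]
        simp only [dualFunctional_coe]
        exact map_add (Subtype.val (show Tensor 𝕂 E x₀ from u)) (alphaLipInclusion h f)
          (alphaLipInclusion h g)
      map_smul' := fun c f => completedTensor_dual_ext h fun u => by
        rw [RingHom.id_apply, smul_apply]
        simp only [dualFunctional_coe]
        exact map_smul (Subtype.val (show Tensor 𝕂 E x₀ from u)) c (alphaLipInclusion h f) }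
    ⟨fun f g hfg => by
      apply Subtype.ext
      funext x
      ext e
      have key : ∀ f : alphaLipSubmodule h,
          dualFunctional h f (completedDelta h x x₀ e) = f.1 x e := fun f => by
        rw [completedDelta, dualFunctional_coe]
        have : (f.1 x - f.1 x₀) e = f.1 x e := by rw [f.2.1, sub_zero]
        exact this
      rw [← key, ← key]
      exact congrArg (· (completedDelta h x x₀ e)) hfg,
    fun Φ => ⟨_, dualFunctional_operatorOfDual h Φ⟩⟩

theorem alphaLipDualEquiv_completedDelta (h : IsLipschitzCrossNorm α) (f : alphaLipSubmodule h)
    (x y : X) (e : E) : alphaLipDualEquiv h f (completedDelta h x y e) = (f.1 x - f.1 y) e :=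
  dualFunctional_coe h f _

theorem norm_alphaLipDualEquiv (h : IsLipschitzCrossNorm α) (f : alphaLipSubmodule h) :
    ‖alphaLipDualEquiv h f‖ = alphaLipNorm α f.1 :=
  norm_dualFunctional h f

end Duality

/-! ### The least Lipschitz constant -/

section LipConst

variable {X : Type u} {Y : Type v} [PseudoMetricSpace X] [PseudoMetricSpace Y] {f : X → Y}

theorem lipConst_nonneg (f : X → Y) : 0 ≤ lipConst f := NNReal.coe_nonneg _

theorem lipConst_le {C : ℝ≥0} (h : LipschitzWith C f) : lipConst f ≤ C :=
  NNReal.coe_le_coe.2 (csInf_le (OrderBot.bddBelow _) h)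

/-- The infimum is attained, so the cost of a factorization is itself an admissible constant, with
no loss of `ε`. -/
theorem lipschitzWith_sInf (h : ∃ C : ℝ≥0, LipschitzWith C f) :
    LipschitzWith (sInf {C : ℝ≥0 | LipschitzWith C f}) f := by
  refine LipschitzWith.of_dist_le_mul fun x y => ?_
  obtain h0 | h0 := (dist_nonneg (x := x) (y := y)).eq_or_lt
  · obtain ⟨C, hC⟩ := h
    have := hC.dist_le_mul x y
    rw [← h0, mul_zero] at this ⊢
    exact this
  · rw [← div_le_iff₀ h0]
    have h1 : (dist (f x) (f y) / dist x y).toNNReal ≤ sInf {C : ℝ≥0 | LipschitzWith C f} :=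
      le_csInf h fun C hC => Real.toNNReal_le_iff_le_coe.2
        ((div_le_iff₀ h0).2 (LipschitzWith.dist_le_mul hC x y))
    exact Real.toNNReal_le_iff_le_coe.1 h1

end LipConst

/-! ### A factorization through `L_{p'}` gives a `w_p`-bound -/

section FactorizationBound

variable {𝕂 : Type k} [RCLike 𝕂] {X : Type u} [MetricSpace X] {x₀ : X}

/-- Only finitely many values of `v` enter, and on those points `v - v x₀` agrees with an element of
`X^#`. The generality is needed because `z ↦ R z ω` need not be Lipschitz for fixed `ω`. -/
theorem Dominated.apply_fun {q : ℝ≥0∞} {n m : ℕ} {a : Fin n → ℝ} {y y' : Fin n → X}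
    {b : Fin m → ℝ} {x x' : Fin m → X} (h : Dominated 𝕂 x₀ q a y y' b x x') (v : X → 𝕂) :
    ‖WithLp.toLp q (fun i => (a i : 𝕂) * (v (y i) - v (y' i)))‖ ≤
      ‖WithLp.toLp q (fun j => (b j : 𝕂) * (v (x j) - v (x' j)))‖ := by
  classical
  obtain ⟨g, hg, hgv⟩ := exists_lip0_eqOn 𝕂 x₀ (insert x₀ ((Finset.univ.image y ∪
    Finset.univ.image y') ∪ (Finset.univ.image x ∪ Finset.univ.image x'))) (by simp) v
  have h1 : ∀ i, g (y i) - g (y' i) = v (y i) - v (y' i) := fun i => by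
    rw [hgv _ (by simp), hgv _ (by simp), sub_sub_sub_cancel_right]
  have h2 : ∀ j, g (x j) - g (x' j) = v (x j) - v (x' j) := fun j => by
    rw [hgv _ (by simp), hgv _ (by simp), sub_sub_sub_cancel_right]
  simpa only [h1, h2] using h g hg

theorem ofReal_sum_norm_rpow {ι F : Type*} [Fintype ι] [SeminormedAddCommGroup F] {s : ℝ}
    (hs : 0 ≤ s) (v : ι → F) :
    ENNReal.ofReal (∑ i, ‖v i‖ ^ s) = ∑ i, ‖v i‖ₑ ^ s := by
  rw [ENNReal.ofReal_sum_of_nonneg fun i _ => by positivity]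
  refine Finset.sum_congr rfl fun i _ => ?_
  rw [← ENNReal.ofReal_rpow_of_nonneg (norm_nonneg _) hs, ofReal_norm]

theorem enorm_sub_rpow_eq_lintegral {Ω : Type*} {_ : MeasurableSpace Ω} {μ : Measure Ω}
    {q : ℝ≥0∞} [h : Fact (1 ≤ q)] (hq : q ≠ ∞) (F G : Lp 𝕂 q μ) :
    ‖F - G‖ₑ ^ q.toReal = ∫⁻ ω, ‖F ω - G ω‖ₑ ^ q.toReal ∂μ := by
  have hq0 : q ≠ 0 := (zero_lt_one.trans_le h.out).ne'
  have hs := toReal_pos_of_fact hq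
  rw [Lp.enorm_def, eLpNorm_eq_lintegral_rpow_enorm_toReal hq0 hq, ← ENNReal.rpow_mul, one_div,
    inv_mul_cancel₀ hs.ne', ENNReal.rpow_one]
  refine lintegral_congr_ae ?_
  filter_upwards [Lp.coeFn_sub F G] with ω hω
  rw [hω, Pi.sub_apply]

/-- For `q < ∞`, apply the scalar domination to `z ↦ R z ω` and integrate its `q`-th power by
linearity. For `q = ∞`, apply it at almost every `ω`, where the finitely many right-hand terms are
bounded by their essential suprema. -/
theorem Dominated.lp {Ω : Type*} {_ : MeasurableSpace Ω} {μ : Measure Ω} {q : ℝ≥0∞}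
    [Fact (1 ≤ q)] {n m : ℕ} {a : Fin n → ℝ} {y y' : Fin n → X}
    {b : Fin m → ℝ} {x x' : Fin m → X} (h : Dominated 𝕂 x₀ q a y y' b x x') (R : X → Lp 𝕂 q μ) :
    ‖WithLp.toLp q (fun i => a i * ‖R (y i) - R (y' i)‖)‖ ≤
      ‖WithLp.toLp q (fun j => b j * ‖R (x j) - R (x' j)‖)‖ := by
  obtain rfl | hq := eq_or_ne q ∞
  · set M := ‖WithLp.toLp ∞ (fun j => b j * ‖R (x j) - R (x' j)‖)‖ with hM
    have hM0 : 0 ≤ M := norm_nonneg _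
    have hMj := (norm_toLp_top_le_iff (fun j => b j * ‖R (x j) - R (x' j)‖) hM0).1 le_rfl
    rw [norm_toLp_top_le_iff _ hM0]
    intro i
    have hb : ∀ᵐ ω ∂μ, ∀ j, ‖(b j : 𝕂) * (R (x j) ω - R (x' j) ω)‖ ≤ M := by
      rw [ae_all_iff]
      intro j
      have h1 := enorm_ae_le_eLpNormEssSup (R (x j) - R (x' j) : Lp 𝕂 ∞ μ) μ
      filter_upwards [h1, Lp.coeFn_sub (R (x j)) (R (x' j))] with ω hω hsub
      rw [hsub, Pi.sub_apply, ← eLpNorm_exponent_top, ← Lp.enorm_def] at hω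
      refine le_trans ?_ (hMj j)
      rw [norm_mul, norm_mul, RCLike.norm_ofReal, Real.norm_eq_abs, norm_norm]
      gcongr
      exact enorm_le_iff_norm_le.1 hω
    have hi : ‖(a i : 𝕂) • (R (y i) - R (y' i))‖ ≤ M := by
      rw [← ENNReal.ofReal_le_ofReal_iff hM0, ofReal_norm, Lp.enorm_def, eLpNorm_exponent_top]
      refine eLpNormEssSup_le_of_ae_bound ?_
      filter_upwards [hb, Lp.coeFn_sub (R (y i)) (R (y' i)),
        Lp.coeFn_smul (a i : 𝕂) (R (y i) - R (y' i))] with ω hω hsub hsmul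
      rw [hsmul, Pi.smul_apply, hsub, Pi.sub_apply, smul_eq_mul]
      have h2 := h.apply_fun fun z => R z ω
      rw [← norm_toLp_top_le_iff (fun j => (b j : 𝕂) * (R (x j) ω - R (x' j) ω)) hM0] at hω
      exact (norm_toLp_top_le_iff _ hM0).1 (h2.trans hω) i
    rwa [norm_smul, RCLike.norm_ofReal, ← Real.norm_eq_abs, ← norm_norm (R (y i) - R (y' i)),
      ← norm_mul] at hi
  · have hs := toReal_pos_of_fact hq
    have key : ∀ {n : ℕ} (a : Fin n → ℝ) (y y' : Fin n → X),
        ENNReal.ofReal (∑ i, ‖a i * ‖R (y i) - R (y' i)‖‖ ^ q.toReal) =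
          ∫⁻ ω, ENNReal.ofReal (∑ i, ‖(a i : 𝕂) * (R (y i) ω - R (y' i) ω)‖ ^ q.toReal) ∂μ := by
      intro n a y y'
      simp only [ofReal_sum_norm_rpow hs.le]
      rw [lintegral_finsetSum']
      · refine Finset.sum_congr rfl fun i _ => ?_
        simp only [enorm_mul, enorm_norm, ENNReal.mul_rpow_of_nonneg _ _ hs.le]
        rw [lintegral_const_mul' _ _ (ENNReal.rpow_ne_top_of_nonneg hs.le enorm_ne_top),
          ← enorm_sub_rpow_eq_lintegral hq]
        congr 2
        rw [← ofReal_norm, ← ofReal_norm, RCLike.norm_ofReal, Real.norm_eq_abs]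
      · intro i _
        have h1 := (Lp.aestronglyMeasurable (R (y i))).sub (Lp.aestronglyMeasurable (R (y' i)))
        exact (h1.const_mul (a i : 𝕂)).enorm.pow_const _
    rw [norm_toLp_le_iff_rpow hq _ (norm_nonneg _), norm_toLp_rpow hq,
      ← ENNReal.ofReal_le_ofReal_iff (by positivity), key, key]
    refine lintegral_mono fun ω => ENNReal.ofReal_le_ofReal ?_
    have h2 := h.apply_fun fun z => R z ω
    rwa [norm_toLp_le_iff_rpow hq _ (norm_nonneg _), norm_toLp_rpow hq] at h2

variable {E : Type v} [NormedAddCommGroup E] [NormedSpace 𝕂 E]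

theorem alphaBound_of_factorization (p : ℝ≥0∞) [Fact (1 ≤ p)] {Ω : Type*} {_ : MeasurableSpace Ω}
    {μ : Measure Ω} (f : Lip0 𝕂 x₀ (StrongDual 𝕂 E)) (R : X → Lp 𝕂 p.conjExponent μ) {K L : ℝ≥0}
    (hR : LipschitzWith K R) (hS : ∀ x y, ‖f.1 x - f.1 y‖ ≤ L * ‖R x - R y‖) :
    AlphaBound (wNorm p : Tensor 𝕂 E x₀ → ℝ) f.1 (K * L) := by
  rw [alphaBound_iff]
  refine fun u => le_mul_wNorm p (by positivity) fun n m a y y' e b x x' hu hd => ?_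
  rw [hu, sum_smul_delta_apply]
  calc ‖∑ i, (a i : 𝕂) * (f.1 (y i) - f.1 (y' i)) (e i)‖
      ≤ ∑ i, L * (‖e i‖ * ‖a i * ‖R (y i) - R (y' i)‖‖) := by
        refine norm_sum_le_of_le _ fun i _ => ?_
        rw [norm_mul, norm_mul, norm_norm, RCLike.norm_ofReal, Real.norm_eq_abs]
        calc |a i| * ‖(f.1 (y i) - f.1 (y' i)) (e i)‖
            ≤ |a i| * ((L * ‖R (y i) - R (y' i)‖) * ‖e i‖) := by
              gcongr
              exact ContinuousLinearMap.le_of_opNorm_le _ (hS _ _) _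
          _ = _ := by ring
    _ ≤ L * (‖WithLp.toLp p e‖ *
          ‖WithLp.toLp p.conjExponent (fun i => a i * ‖R (y i) - R (y' i)‖)‖) := by
        rw [← Finset.mul_sum]
        exact mul_le_mul_of_nonneg_left (sum_norm_mul_norm_le inferInstance _ _) L.2
    _ ≤ L * (‖WithLp.toLp p e‖ *
          (K * ‖WithLp.toLp p.conjExponent (fun j => b j * dist (x j) (x' j))‖)) := by
        gcongr
        refine (hd.lp R).trans (norm_toLp_mul_le K.2 fun j => ?_)
        rw [norm_mul, norm_norm, Real.norm_eq_abs, abs_mul, abs_of_nonneg dist_nonneg,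
          ← dist_eq_norm]
        calc |b j| * dist (R (x j)) (R (x' j)) ≤ |b j| * (K * dist (x j) (x' j)) := by
              gcongr; exact hR.dist_le_mul _ _
          _ = _ := by ring
    _ = _ := by ring

theorem alphaBound_of_mem_factorCosts (p : ℝ≥0∞) [Fact (1 ≤ p)] (f : Lip0 𝕂 x₀ (StrongDual 𝕂 E))
    {c : ℝ} (hc : c ∈ factorCosts.{u, max v k, w, k} 𝕂 p.conjExponent f.1) :
    0 ≤ c ∧ AlphaBound (wNorm p : Tensor 𝕂 E x₀ → ℝ) f.1 c := by
  obtain ⟨Ω, _, μ, Z, R, S, hR, hS, hf, rfl⟩ := hc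
  refine ⟨mul_nonneg (lipConst_nonneg R) (lipConst_nonneg S), ?_⟩
  refine alphaBound_of_factorization p f (fun x => (R x : Lp 𝕂 p.conjExponent μ))
    (lipschitzWith_sInf hR) fun x y => ?_
  rw [hf, ← dist_eq_norm, ← dist_eq_norm]
  exact (lipschitzWith_sInf hS).dist_le_mul (R x) (R y)

theorem exists_lipschitz_of_mem_factorCosts {q : ℝ≥0∞} [Fact (1 ≤ q)] {Y : Type v} [MetricSpace Y]
    {f : X → Y} {c : ℝ} (hc : c ∈ factorCosts.{u, v, w, k} 𝕂 q f) :
    ∃ C : ℝ≥0, LipschitzWith C f := by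
  obtain ⟨Ω, _, μ, Z, R, S, ⟨C, hC⟩, ⟨D, hD⟩, hf, -⟩ := hc
  exact ⟨D * C, hf ▸ hD.comp hC⟩

end FactorizationBound

/-! ### From `w_p`-bounds to factorizations: the case `L_∞` and the discrete inequality -/

section Converse

variable {𝕂 : Type k} [RCLike 𝕂] {X : Type u} [MetricSpace X] {x₀ : X}

/-- The hypothesis on `dist` makes `f` descend to a 1-Lipschitz map on the range of `R`, so the
whole cost sits in `R`. -/
theorem exists_mem_factorCosts_le {Y : Type v} [MetricSpace Y] {q : ℝ≥0∞} [Fact (1 ≤ q)]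
    {Ω : Type w} [mΩ : MeasurableSpace Ω] {μ : Measure Ω} {f : X → Y} (R : X → Lp 𝕂 q μ) {K : ℝ≥0}
    (hR : LipschitzWith K R) (hS : ∀ x y, dist (f x) (f y) ≤ dist (R x) (R y)) :
    ∃ c ∈ factorCosts.{u, v, w, k} 𝕂 q f, c ≤ K := by
  set R' : X → Set.range R := fun x => ⟨R x, x, rfl⟩ with hR'
  set S : Set.range R → Y := fun z => f z.2.choose with hSdef
  have hS1 : LipschitzWith 1 S := LipschitzWith.of_dist_le_mul fun z z' => by
    refine (hS _ _).trans ?_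
    rw [z.2.choose_spec, z'.2.choose_spec, NNReal.coe_one, one_mul]
    rfl
  have hR1 : LipschitzWith K R' := fun x y => hR x y
  refine ⟨lipConst R' * lipConst S, ⟨Ω, mΩ, μ, Set.range R, R', S, ⟨K, hR1⟩, ⟨1, hS1⟩, ?_, rfl⟩, ?_⟩
  · funext x
    refine dist_le_zero.1 ((hS _ _).trans ?_)
    rw [(R' x).2.choose_spec, dist_self]
  · calc lipConst R' * lipConst S ≤ K * (1 : ℝ≥0) :=
        mul_le_mul (lipConst_le hR1) (lipConst_le hS1) (lipConst_nonneg S) K.2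
      _ = K := by simp

theorem exists_mem_factorCosts_top_le {Y : Type v} [MetricSpace Y] {f : X → Y} {K : ℝ≥0}
    (hf : LipschitzWith K f) :
    ∃ c ∈ factorCosts.{u, v, max u k w, k} 𝕂 ∞ f, c ≤ K := by
  obtain hX | hX := isEmpty_or_nonempty X
  · exact exists_mem_factorCosts_le (Ω := ULift.{max u k w} PUnit) (mΩ := ⊤) (μ := 0)
      (fun x => (hX.false x).elim) (fun x => (hX.false x).elim) (fun x => (hX.false x).elim)
  let x₀ : X := hX.some
  let _ : MeasurableSpace (ULift.{max k w} X) := ⊤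
  -- Kuratowski embedding scaled by `K`: subtracting `dist x₀ ·` makes it bounded, and the
  -- coordinate `z = y` recovers `K * dist x y`.
  set r : X → ULift.{max k w} X → 𝕂 := fun x z =>
    ((K * (dist x z.down - dist x₀ z.down) : ℝ) : 𝕂) with hr
  have hdiff : ∀ x y z, ‖r x z - r y z‖ = K * |dist x z.down - dist y z.down| := fun x y z => by
    rw [hr, ← RCLike.ofReal_sub, RCLike.norm_ofReal, ← mul_sub, abs_mul, sub_sub_sub_cancel_right,
      NNReal.abs_eq]
  have hmem : ∀ x, MemLp (r x) ∞ (Measure.count : Measure (ULift.{max k w} X)) := fun x => by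
    refine memLp_top_of_bound measurable_from_top.aestronglyMeasurable (K * dist x x₀) ?_
    refine Filter.Eventually.of_forall fun z => ?_
    rw [hr, RCLike.norm_ofReal, abs_mul, NNReal.abs_eq]
    exact mul_le_mul_of_nonneg_left (abs_dist_sub_le _ _ _) K.2
  refine exists_mem_factorCosts_le (fun x => (hmem x).toLp (r x)) ?_ ?_
  · refine LipschitzWith.of_dist_le_mul fun x y => ?_
    rw [dist_eq_norm, ← MemLp.toLp_sub, Lp.norm_toLp, eLpNorm_exponent_top]
    refine ENNReal.toReal_le_of_le_ofReal (by positivity) (eLpNormEssSup_le_of_ae_bound ?_)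
    refine Filter.Eventually.of_forall fun z => ?_
    rw [Pi.sub_apply, hdiff]
    exact mul_le_mul_of_nonneg_left (abs_dist_sub_le _ _ _) K.2
  · intro x y
    refine (hf.dist_le_mul x y).trans ?_
    rw [dist_eq_norm ((hmem x).toLp (r x)), ← MemLp.toLp_sub, Lp.norm_toLp]
    have h2 : ‖(r x - r y) ⟨y⟩‖ₑ ≤ eLpNorm (r x - r y) ∞ Measure.count :=
      Measure.ae_count_iff.1 (enorm_ae_le_eLpNormEssSup (r x - r y) Measure.count) ⟨y⟩
    have h3 := ENNReal.toReal_mono ((hmem x).sub (hmem y)).2.ne h2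
    rwa [toReal_enorm, Pi.sub_apply, hdiff, dist_self, sub_zero, abs_dist] at h3

variable {E : Type v} [NormedAddCommGroup E] [NormedSpace 𝕂 E]

/-- The norm of `φ` need not be attained, hence the factor `c`; a rotation by the phase of `φ e`
makes the value real. -/
theorem exists_norm_le_one_apply_eq_ofReal (φ : StrongDual 𝕂 E) {c : ℝ} (hc : c < 1) :
    ∃ (e : E) (r : ℝ), ‖e‖ ≤ 1 ∧ φ e = (r : 𝕂) ∧ c * ‖φ‖ ≤ r := by
  obtain h0 | h0 := (norm_nonneg φ).eq_or_lt
  · exact ⟨0, 0, by simp, by simp, by simp [← h0]⟩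
  · obtain ⟨e, he, hlt⟩ := φ.exists_lt_apply_of_lt_opNorm (r := c * ‖φ‖) (by nlinarith)
    obtain h1 | h1 := (norm_nonneg (φ e)).eq_or_lt
    · exact ⟨0, 0, by simp, by simp, by rw [← h1] at hlt; exact hlt.le⟩
    · refine ⟨((‖φ e‖⁻¹ : ℝ) * (starRingEnd 𝕂) (φ e) : 𝕂) • e, ‖φ e‖, ?_, ?_, hlt.le⟩
      · rw [norm_smul, norm_mul, RCLike.norm_ofReal, RCLike.norm_conj, abs_of_nonneg (by positivity),
          inv_mul_cancel₀ h1.ne', one_mul]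
        exact he.le
      · rw [map_smul, smul_eq_mul, mul_assoc, RCLike.conj_mul]
        have : (‖φ e‖ : 𝕂) ≠ 0 := by exact_mod_cast h1.ne'
        push_cast
        field_simp

theorem le_of_forall_mul_lt_one_le {a b : ℝ} (h : ∀ c < 1, a * c ≤ b) : a ≤ b := by
  have h1 : Filter.Tendsto (fun c : ℝ => a * c) (nhdsWithin 1 (Set.Iio 1)) (nhds (a * 1)) :=
    ((continuous_const_mul a).tendsto 1).mono_left nhdsWithin_le_nhds
  rw [mul_one] at h1
  exact le_of_tendsto h1 (eventually_nhdsWithin_of_forall h)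

/-- Test `f` on the tensor with vectors `t i • e i`, where `e i` almost norms `f (y i) - f (y' i)`.
Its `w_p` is at most `‖t‖_p` times the dominating sum, and converse Hölder over `t` removes `t`. -/
theorem AlphaBound.norm_toLp_le {p : ℝ≥0∞} [Fact (1 ≤ p)] (hp : p ≠ 1) {f : X → StrongDual 𝕂 E}
    {C : ℝ} (hC : 0 ≤ C) (hf : AlphaBound (wNorm p : Tensor 𝕂 E x₀ → ℝ) f C)
    {n m : ℕ} {a : Fin n → ℝ} {y y' : Fin n → X}
    {b : Fin m → ℝ} {x x' : Fin m → X} (h : Dominated 𝕂 x₀ p.conjExponent a y y' b x x') :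
    ‖WithLp.toLp p.conjExponent (fun i => |a i| * ‖f (y i) - f (y' i)‖)‖ ≤
      C * ‖WithLp.toLp p.conjExponent (fun j => b j * dist (x j) (x' j))‖ := by
  refine norm_toLp_le_of_forall_sum_mul_le (p := p) inferInstance hp (fun i => by positivity)
    (by positivity) fun t ht => ?_
  refine le_of_forall_mul_lt_one_le fun c hc => ?_
  choose e r he her hr using fun i =>
    exists_norm_le_one_apply_eq_ofReal (f (y i) - f (y' i)) hc
  -- The sign turns `a i` into `|a i|`, so that no cancellation occurs in the sum.
  set e' : Fin n → E := fun i => ((t i * (SignType.sign (a i) : ℝ) : ℝ) : 𝕂) • e i with he'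
  have hu : ∑ i, delta 𝕂 x₀ (y i) (y' i) ((a i : 𝕂) • e' i) =
      ∑ i, (a i : 𝕂) • delta 𝕂 x₀ (y i) (y' i) (e' i) := by simp only [smul_delta]
  have h1 := (hf n y y' fun i => (a i : 𝕂) • e' i).trans
    (mul_le_mul_of_nonneg_left (wNorm_le_of_eq p hu h) hC)
  have h2 : ∀ i, (f (y i) - f (y' i)) ((a i : 𝕂) • e' i) = ((|a i| * t i * r i : ℝ) : 𝕂) := by
    intro i
    rw [he', smul_smul, map_smul, her, smul_eq_mul, ← RCLike.ofReal_mul, ← RCLike.ofReal_mul,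
      ← self_mul_sign (a i)]
    congr 1
    ring
  simp only [h2, ← RCLike.ofReal_sum, RCLike.norm_ofReal] at h1
  have h3 : ‖WithLp.toLp p e'‖ ≤ ‖WithLp.toLp p t‖ := by
    refine norm_toLp_mono fun i => ?_
    have h4 : |(SignType.sign (a i) : ℝ)| ≤ 1 := by
      rcases lt_trichotomy (a i) 0 with h | h | h <;> simp [h]
    rw [he', norm_smul, RCLike.norm_ofReal, abs_mul, Real.norm_eq_abs]
    calc |t i| * |(SignType.sign (a i) : ℝ)| * ‖e i‖ ≤ |t i| * 1 * 1 := by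
          gcongr
          exact he i
      _ = |t i| := by ring
  calc (∑ i, |a i| * ‖f (y i) - f (y' i)‖ * t i) * c
      = ∑ i, |a i| * t i * (c * ‖f (y i) - f (y' i)‖) := by
        rw [Finset.sum_mul]; exact Finset.sum_congr rfl fun i _ => by ring
    _ ≤ ∑ i, |a i| * t i * r i := Finset.sum_le_sum fun i _ =>
        mul_le_mul_of_nonneg_left (hr i) (mul_nonneg (abs_nonneg _) (ht i))
    _ ≤ _ := le_abs_self _
    _ ≤ _ := h1
    _ ≤ C * (‖WithLp.toLp p t‖ *
        ‖WithLp.toLp p.conjExponent (fun j => b j * dist (x j) (x' j))‖) := by gcongr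
    _ = _ := by ring

end Converse

/-! ### A positive functional by M. Riesz extension -/

section PositiveFunctional

/-- Existence of a positive linear functional with prescribed bounds on a family of vectors. -/
theorem exists_positive_functional {V Ω ι : Type*} [AddCommGroup V] [Module ℝ V]
    (ev : V →ₗ[ℝ] (Ω → ℝ)) (φ : ι → V) (l D : ι → ℝ)
    (dom : ∀ v : V, ∃ β : ι →₀ ℝ≥0, ∀ g, 0 ≤ ev (v + Finsupp.linearCombination ℝ≥0 φ β) g)
    (cons : ∀ α β : ι →₀ ℝ≥0, (∀ g, ev (Finsupp.linearCombination ℝ≥0 φ α) g ≤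
      ev (Finsupp.linearCombination ℝ≥0 φ β) g) →
      Finsupp.linearCombination ℝ≥0 l α ≤ Finsupp.linearCombination ℝ≥0 D β) :
    ∃ I : V →ₗ[ℝ] ℝ, (∀ v, (∀ g, 0 ≤ ev v g) → 0 ≤ I v) ∧
      ∀ i, l i ≤ I (φ i) ∧ I (φ i) ≤ D i := by
  -- The cone generated by the pairs `(v, r)` with `ev v ≥ 0` and `r ≥ 0`, and by all `(φ i, -l i)`
  -- and `(-φ i, D i)`. Nonnegativity on it, with `G (0, r) = r`, encodes positivity and the two
  -- bounds.
  let s : PointedCone ℝ (V × ℝ) :=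
    { carrier := {z | ∃ α β : ι →₀ ℝ≥0, (∀ g, ev (Finsupp.linearCombination ℝ≥0 φ α) g ≤
        ev (z.1 + Finsupp.linearCombination ℝ≥0 φ β) g) ∧
        Finsupp.linearCombination ℝ≥0 D β ≤ z.2 + Finsupp.linearCombination ℝ≥0 l α}
      zero_mem' := ⟨0, 0, by simp, by simp⟩
      add_mem' := by
        rintro ⟨v, r⟩ ⟨v', r'⟩ ⟨α, β, h1, h2⟩ ⟨α', β', h1', h2'⟩
        refine ⟨α + α', β + β', fun g => ?_, ?_⟩
        · have := add_le_add (h1 g) (h1' g)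
          simp only [map_add, Pi.add_apply, Prod.fst_add] at this ⊢
          linarith
        · simp only [map_add, Prod.snd_add] at h2 h2' ⊢
          linarith
      smul_mem' := by
        intro (c : ℝ≥0) z hz
        obtain ⟨α, β, h1, h2⟩ := hz
        refine ⟨c • α, c • β, fun g => ?_, ?_⟩
        · have h3 := mul_le_mul_of_nonneg_left (h1 g) c.2
          have e1 : Finsupp.linearCombination ℝ≥0 φ (c • α) =
            (c : ℝ) • Finsupp.linearCombination ℝ≥0 φ α := map_smul _ c α
          have e2 : Finsupp.linearCombination ℝ≥0 φ (c • β) =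
            (c : ℝ) • Finsupp.linearCombination ℝ≥0 φ β := map_smul _ c β
          change _ ≤ ev ((c : ℝ) • z.1 + _) g
          rw [e1, e2, ← smul_add, map_smul, map_smul]
          exact h3
        · have h3 := mul_le_mul_of_nonneg_left h2 c.2
          have e1 : Finsupp.linearCombination ℝ≥0 l (c • α) =
            (c : ℝ) * Finsupp.linearCombination ℝ≥0 l α := map_smul _ c α
          have e2 : Finsupp.linearCombination ℝ≥0 D (c • β) =
            (c : ℝ) * Finsupp.linearCombination ℝ≥0 D β := map_smul _ c β
          change _ ≤ (c : ℝ) * z.2 + _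
          rw [e1, e2, ← mul_add]
          exact h3 }
  have hmem : ∀ v r, (v, r) ∈ s ↔ ∃ α β : ι →₀ ℝ≥0,
      (∀ g, ev (Finsupp.linearCombination ℝ≥0 φ α) g ≤
        ev (v + Finsupp.linearCombination ℝ≥0 φ β) g) ∧
      Finsupp.linearCombination ℝ≥0 D β ≤ r + Finsupp.linearCombination ℝ≥0 l α :=
    fun _ _ => Iff.rfl
  -- The functional to extend is `(0, r) ↦ r`: `cons` makes it nonnegative on the cone and `dom`
  -- gives cofinality.
  let F : V × ℝ →ₗ.[ℝ] ℝ :=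
    { domain := (⊥ : Submodule ℝ V).prod ⊤
      toFun := LinearMap.snd ℝ V ℝ ∘ₗ Submodule.subtype _ }
  obtain ⟨G, hG1, hG2⟩ := riesz_extension s F (by
    rintro ⟨⟨v, r⟩, hv⟩ hz
    have hv0 : v = 0 := by simpa using hv.1
    obtain ⟨α, β, h1, h2⟩ := (hmem v r).1 hz
    rw [hv0, zero_add] at h1
    have := cons α β h1
    change (0 : ℝ) ≤ r
    linarith) (by
    rintro ⟨v, t⟩
    obtain ⟨β, hβ⟩ := dom v
    refine ⟨⟨(0, Finsupp.linearCombination ℝ≥0 D β - t), Submodule.zero_mem _, trivial⟩, ?_⟩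
    refine (hmem _ _).2 ⟨0, β, fun g => ?_, ?_⟩
    · simpa using hβ g
    · simp)
  have hG0 : ∀ r, G (0, r) = r := fun r => hG1 ⟨(0, r), Submodule.zero_mem _, trivial⟩
  have hadd : ∀ v r, G (v, r) = G (v, 0) + r := fun v r => by
    rw [← hG0 r, ← map_add, hG0]
    simp
  refine ⟨G ∘ₗ LinearMap.inl ℝ V ℝ, fun v hv => hG2 _ ?_, fun i => ⟨?_, ?_⟩⟩
  · exact (hmem _ _).2 ⟨0, 0, fun g => by simpa using hv g, by simp⟩
  · have := hG2 (φ i, -l i) ((hmem _ _).2 ⟨Finsupp.single i 1, 0, fun g => by simp, by simp⟩)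
    rw [hadd] at this
    simpa using this
  · have := hG2 (-φ i, D i) ((hmem _ _).2 ⟨0, Finsupp.single i 1, fun g => by simp, by simp⟩)
    have hneg : G (-φ i, 0) = - G (φ i, 0) := by
      rw [← map_neg]
      simp
    rw [hadd, hneg] at this
    simp only [LinearMap.comp_apply, LinearMap.inl_apply]
    linarith

end PositiveFunctional

/-! ### Upper bounds of chains of measures -/

section MeasureSup

variable {Ω : Type*} [MeasurableSpace Ω]

theorem finsetSum_iSup_chain {c : Set (Measure Ω)} (hc : IsChain (· ≤ ·) c) {ι : Type*}
    (s : Finset ι) (r : ι → ℝ≥0∞) (t : ι → Set Ω) :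
    ∑ i ∈ s, r i * ⨆ μ : c, μ.1 (t i) = ⨆ μ : c, ∑ i ∈ s, r i * μ.1 (t i) := by
  simp only [ENNReal.mul_iSup]
  refine ENNReal.finsetSum_iSup fun μ ν => ?_
  obtain h | h := hc.total μ.2 ν.2
  · exact ⟨ν, fun i => ⟨mul_le_mul_right (h _) _, le_rfl⟩⟩
  · exact ⟨μ, fun i => ⟨le_rfl, mul_le_mul_right (h _) _⟩⟩

/-- A chain of measures has an upper bound whose integrals are controlled by those of the members
of the chain. -/
theorem exists_measure_upperBound {c : Set (Measure Ω)} (hc : IsChain (· ≤ ·) c) :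
    ∃ m : Measure Ω, (∀ μ ∈ c, μ ≤ m) ∧
      ∀ (f : Ω → ℝ≥0∞) (B : ℝ≥0∞), (∀ μ ∈ c, ∫⁻ ω, f ω ∂μ ≤ B) → ∫⁻ ω, f ω ∂m ≤ B := by
  -- The setwise supremum is countably additive because suprema along a chain commute with finite
  -- sums. The empty chain gives the zero measure.
  let m : Measure Ω := Measure.ofMeasurable (fun s _ => ⨆ μ : c, μ.1 s) (by simp) (by
    intro f hf hd
    have h1 : ∀ μ : c, μ.1 (⋃ i, f i) = ∑' i, μ.1 (f i) := fun μ => measure_iUnion hd hf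
    simp only [h1, ENNReal.tsum_eq_iSup_sum]
    rw [iSup_comm]
    refine iSup_congr fun s => ?_
    simpa using (finsetSum_iSup_chain hc s (fun _ => 1) f).symm)
  have hm : ∀ s, MeasurableSet s → m s = ⨆ μ : c, μ.1 s := fun s hs =>
    Measure.ofMeasurable_apply s hs
  refine ⟨m, fun μ hμ => Measure.le_iff.2 fun s hs => ?_, fun f B hB => ?_⟩
  · rw [hm s hs]
    exact le_iSup (fun μ : c => μ.1 s) ⟨μ, hμ⟩
  · rw [lintegral]
    refine iSup₂_le fun g hg => ?_
    rw [SimpleFunc.lintegral, Finset.sum_congr rfl fun x _ => by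
      rw [hm _ (g.measurableSet_fiber x)], finsetSum_iSup_chain hc g.range (fun x => x)
        fun x => g ⁻¹' {x}]
    refine iSup_le fun μ => le_trans ?_ (hB μ.1 μ.2)
    rw [lintegral]
    exact le_iSup₂ (f := fun (g : SimpleFunc Ω ℝ≥0∞) (_ : ⇑g ≤ f) => g.lintegral μ.1) g hg

end MeasureSup

/-! ### Homogeneous functions of finitely many coordinates on `𝕂^X` -/

section HomogeneousFunctions

variable (𝕂 : Type k) [RCLike 𝕂] (X : Type u)

/-- The continuous functions on `𝕂^X` that are homogeneous of degree `s`, depend on finitely many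
coordinates, and are dominated by a multiple of the sum of the `s`-th powers of those coordinates. -/
def HomFun (s : ℝ) : Submodule ℝ ((X → 𝕂) → ℝ) where
  carrier := {h | Continuous h ∧ (∀ (c : 𝕂) (g : X → 𝕂), h (fun y => c * g y) = ‖c‖ ^ s * h g) ∧
    ∃ F : Finset X, DependsOn h F ∧ ∃ K : ℝ≥0, ∀ g, |h g| ≤ K * ∑ y ∈ F, ‖g y‖ ^ s}
  zero_mem' := ⟨continuous_const, by simp, ∅, fun _ _ _ => rfl, 0, by simp⟩
  add_mem' := by
    classical
    rintro h h' ⟨h1, h2, F, h3, K, h4⟩ ⟨h1', h2', F', h3', K', h4'⟩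
    refine ⟨h1.add h1', fun c g => ?_, F ∪ F', fun g g' hg => ?_, K + K', fun g => ?_⟩
    · rw [Pi.add_apply, Pi.add_apply, h2, h2', mul_add]
    · rw [Pi.add_apply, Pi.add_apply, h3 fun i hi => hg i (by simp_all),
        h3' fun i hi => hg i (by simp_all)]
    · have hF : ∑ y ∈ F, ‖g y‖ ^ s ≤ ∑ y ∈ F ∪ F', ‖g y‖ ^ s :=
        Finset.sum_le_sum_of_subset_of_nonneg Finset.subset_union_left fun _ _ _ => by positivity
      have hF' : ∑ y ∈ F', ‖g y‖ ^ s ≤ ∑ y ∈ F ∪ F', ‖g y‖ ^ s :=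
        Finset.sum_le_sum_of_subset_of_nonneg Finset.subset_union_right fun _ _ _ => by positivity
      rw [Pi.add_apply, NNReal.coe_add, add_mul]
      exact (abs_add_le _ _).trans (add_le_add
        ((h4 g).trans (mul_le_mul_of_nonneg_left hF K.2))
        ((h4' g).trans (mul_le_mul_of_nonneg_left hF' K'.2)))
  smul_mem' := by
    rintro c h ⟨h1, h2, F, h3, K, h4⟩
    refine ⟨h1.const_smul c, fun d g => ?_, F, fun g g' hg => ?_, ‖c‖₊ * K, fun g => ?_⟩
    · rw [Pi.smul_apply, Pi.smul_apply, h2, smul_eq_mul, smul_eq_mul]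
      ring
    · rw [Pi.smul_apply, Pi.smul_apply, h3 hg]
    · rw [Pi.smul_apply, smul_eq_mul, abs_mul, NNReal.coe_mul, coe_nnnorm, Real.norm_eq_abs,
        mul_assoc]
      exact mul_le_mul_of_nonneg_left (h4 g) (abs_nonneg c)

variable {𝕂 X}

theorem norm_sub_rpow_le {s : ℝ} (hs : 0 ≤ s) (a b : 𝕂) :
    ‖a - b‖ ^ s ≤ 2 ^ s * (‖a‖ ^ s + ‖b‖ ^ s) := by
  have h1 : ‖a - b‖ ≤ 2 * max ‖a‖ ‖b‖ := by
    refine (norm_sub_le a b).trans ?_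
    linarith [le_max_left ‖a‖ ‖b‖, le_max_right ‖a‖ ‖b‖]
  calc ‖a - b‖ ^ s ≤ (2 * max ‖a‖ ‖b‖) ^ s := Real.rpow_le_rpow (norm_nonneg _) h1 hs
    _ = 2 ^ s * max ‖a‖ ‖b‖ ^ s := Real.mul_rpow (by norm_num) (by positivity)
    _ ≤ _ := by
      gcongr
      obtain h | h := max_cases ‖a‖ ‖b‖ <;> rw [h.1]
      · exact le_add_of_nonneg_right (by positivity)
      · exact le_add_of_nonneg_left (by positivity)

/-- The function `g ↦ |g x| ^ s`. -/
noncomputable def powFun {s : ℝ} (hs : 0 < s) (x : X) : HomFun 𝕂 X s :=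
  ⟨fun g => ‖g x‖ ^ s, (continuous_apply x).norm.rpow_const fun _ => Or.inr hs.le,
    fun c g => by simp only [norm_mul, Real.mul_rpow (norm_nonneg _) (norm_nonneg _)],
    {x}, fun g g' h => by simp only [h x (by simp)], 1, fun g => by
      simp [abs_of_nonneg (Real.rpow_nonneg (norm_nonneg (g x)) s)]⟩

/-- The function `g ↦ |g x - g y| ^ s`. -/
noncomputable def subPowFun {s : ℝ} (hs : 0 < s) (z : X × X) : HomFun 𝕂 X s :=
  ⟨fun g => ‖g z.1 - g z.2‖ ^ s,
    ((continuous_apply z.1).sub (continuous_apply z.2)).norm.rpow_const fun _ => Or.inr hs.le,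
    fun c g => by simp only [← mul_sub, norm_mul, Real.mul_rpow (norm_nonneg _) (norm_nonneg _)],
    by
      classical
      refine ⟨{z.1, z.2}, fun g g' h => by simp only [h z.1 (by simp), h z.2 (by simp)],
        2 * 2 ^ s, fun g => ?_⟩
      rw [abs_of_nonneg (by positivity)]
      refine (norm_sub_rpow_le hs.le _ _).trans ?_
      have h1 : ∀ w ∈ ({z.1, z.2} : Finset X),
          ‖g w‖ ^ s ≤ ∑ y ∈ ({z.1, z.2} : Finset X), ‖g y‖ ^ s := fun w hw =>
        Finset.single_le_sum (f := fun y => ‖g y‖ ^ s) (fun _ _ => by positivity) hw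
      have h2 := h1 z.1 (by simp)
      have h3 := h1 z.2 (by simp)
      push_cast
      have h4 : (0 : ℝ) ≤ 2 ^ s := by positivity
      nlinarith⟩

/-- For uncountable `X` continuity alone does not give measurability for the product σ-algebra; here
`h` factors through the finite power `𝕂^F`. -/
theorem HomFun.measurable {s : ℝ} (h : HomFun 𝕂 X s) : Measurable h.1 := by
  classical
  obtain ⟨h, hc, -, F, hF, -⟩ := h
  let e : (F → 𝕂) → X → 𝕂 := fun t y => if hy : y ∈ F then t ⟨y, hy⟩ else 0
  have he : Continuous e := continuous_pi fun y => by
    by_cases hy : y ∈ F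
    · simpa [e, hy] using continuous_apply (⟨y, hy⟩ : F)
    · simpa [e, hy] using continuous_const
  have heq : h = (h ∘ e) ∘ fun g (y : F) => g y := by
    funext g
    refine hF fun y hy => ?_
    have : y ∈ F := hy
    simp [e, this]
  change Measurable h
  rw [heq]
  exact (hc.comp he).measurable.comp (measurable_pi_lambda _ fun y => measurable_pi_apply _)

/-- A homogeneous function is bounded by a combination of the functions `powFun`. -/
theorem HomFun.exists_abs_le {s : ℝ} (hs : 0 < s) (h : HomFun 𝕂 X s) :
    ∃ (F : Finset X) (K : ℝ≥0), DependsOn h.1 F ∧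
      ∀ g, |h.1 g| ≤ ((K : ℝ) • ∑ y ∈ F, powFun hs y : HomFun 𝕂 X s).1 g := by
  obtain ⟨h, -, -, F, hF, K, hK⟩ := h
  refine ⟨F, K, hF, fun g => (hK g).trans_eq ?_⟩
  simp [powFun, Finset.sum_apply]

end HomogeneousFunctions

/-! ### Extension of positive functionals and Riesz–Markov on a compact space -/

section PositiveExtension

/-- Extension of a positive functional from one function space to another one that it majorizes. -/
theorem exists_positive_extension {V W Ω : Type*} [AddCommGroup V] [Module ℝ V] [AddCommGroup W]
    [Module ℝ W] (ev : V →ₗ[ℝ] (Ω → ℝ)) (ew : W →ₗ[ℝ] (Ω → ℝ)) (J : V →ₗ[ℝ] ℝ)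
    (hJ : ∀ v, (∀ g, 0 ≤ ev v g) → 0 ≤ J v)
    (dom : ∀ w, ∃ v, ∀ g, 0 ≤ ev v g + ew w g) :
    ∃ L : W →ₗ[ℝ] ℝ, ∀ v w, (∀ g, 0 ≤ ev v g + ew w g) → 0 ≤ J v + L w := by
  -- Positivity of the joint functional `J v + L w` on this cone ties `L` to `J`: it transfers
  -- pointwise inequalities between `V` and `W` in both directions.
  let s : PointedCone ℝ (V × W) :=
    { carrier := {z | ∀ g, 0 ≤ ev z.1 g + ew z.2 g}
      zero_mem' := fun g => by simp
      add_mem' := fun {z z'} h h' g => by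
        have := add_nonneg (h g) (h' g)
        simp only [Prod.fst_add, Prod.snd_add, map_add, Pi.add_apply]
        linarith
      smul_mem' := by
        intro (c : ℝ≥0) z hz g
        have h1 := mul_nonneg c.2 (hz g)
        change 0 ≤ ev ((c : ℝ) • z.1) g + ew ((c : ℝ) • z.2) g
        rw [map_smul, map_smul, Pi.smul_apply, Pi.smul_apply, ← smul_add]
        exact h1 }
  have hmem : ∀ v w, (v, w) ∈ s ↔ ∀ g, 0 ≤ ev v g + ew w g := fun _ _ => Iff.rfl
  let F : V × W →ₗ.[ℝ] ℝ :=
    { domain := (⊤ : Submodule ℝ V).prod ⊥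
      toFun := J ∘ₗ LinearMap.fst ℝ V W ∘ₗ Submodule.subtype _ }
  obtain ⟨G, hG1, hG2⟩ := riesz_extension s F (by
    rintro ⟨⟨v, w⟩, hv⟩ hz
    have hw0 : w = 0 := by simpa using hv.2
    have hz := (hmem v w).1 hz
    rw [hw0] at hz
    exact hJ v fun g => by simpa using hz g) (by
    rintro ⟨v, w⟩
    obtain ⟨v', hv'⟩ := dom w
    refine ⟨⟨(v' - v, 0), trivial, Submodule.zero_mem _⟩, ?_⟩
    have h1 : ((v' - v, 0) : V × W) + (v, w) = (v', w) := by simp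
    change ((v' - v, 0) : V × W) + (v, w) ∈ s
    rw [h1]
    exact (hmem _ _).2 hv')
  refine ⟨G ∘ₗ LinearMap.inr ℝ V W, fun v w h => ?_⟩
  have h1 := hG2 _ ((hmem v w).2 h)
  have h2 : G (v, 0) = J v := hG1 ⟨(v, 0), trivial, Submodule.zero_mem _⟩
  have h3 : G (v, w) = G (v, 0) + G (0, w) := by
    rw [← map_add]
    simp
  rw [h3, h2] at h1
  exact h1

theorem exists_measure_of_positive {K : Type*} [TopologicalSpace K] [CompactSpace K] [T2Space K]
    [MeasurableSpace K] [BorelSpace K] (L : C(K, ℝ) →ₗ[ℝ] ℝ)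
    (hL : ∀ φ : C(K, ℝ), (∀ z, 0 ≤ φ z) → 0 ≤ L φ) :
    ∃ ν : Measure K, ∀ φ : C(K, ℝ), (∀ z, 0 ≤ φ z) →
      ∫⁻ z, ENNReal.ofReal (φ z) ∂ν = ENNReal.ofReal (L φ) := by
  let L' : CompactlySupportedContinuousMap K ℝ →ₗ[ℝ] ℝ :=
    { toFun := fun f => L f.toContinuousMap
      map_add' := fun f g => (congrArg L rfl).trans (map_add L f.toContinuousMap g.toContinuousMap)
      map_smul' := fun c f => (congrArg L rfl).trans (map_smul L c f.toContinuousMap) }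
  let Λ : CompactlySupportedContinuousMap K ℝ →ₚ[ℝ] ℝ :=
    PositiveLinearMap.mk₀ L' fun f hf => hL _ hf
  refine ⟨RealRMK.rieszMeasure Λ, fun φ hφ => ?_⟩
  let f : CompactlySupportedContinuousMap K ℝ :=
    ⟨φ, HasCompactSupport.of_compactSpace φ⟩
  have h1 : ∫ z, f z ∂(RealRMK.rieszMeasure Λ) = L φ := RealRMK.integral_rieszMeasure Λ f
  rw [← h1, ofReal_integral_eq_lintegral_ofReal]
  · rfl
  · exact f.continuous.integrable_of_hasCompactSupport f.hasCompactSupport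
  · exact Filter.Eventually.of_forall hφ

end PositiveExtension

/-! ### Cutoff functions on the one-point compactification of `𝕂` -/

section Cutoff

variable {𝕂 : Type k} [RCLike 𝕂]

theorem continuous_onePoint_elim {Y : Type*} [TopologicalSpace Y] [Zero Y] {f : 𝕂 → Y}
    (hf : Continuous f) (r : ℝ) (h : ∀ z, r < ‖z‖ → f z = 0) :
    Continuous fun z : OnePoint 𝕂 => z.elim 0 f := by
  refine (OnePoint.continuousMapMk ⟨f, hf⟩ 0 ?_).continuous
  refine Filter.Tendsto.congr' (f₁ := fun _ => 0) ?_ tendsto_const_nhds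
  rw [Filter.coclosedCompact_eq_cocompact]
  filter_upwards [(isCompact_closedBall (0 : 𝕂) r).compl_mem_cocompact] with z hz
  exact (h z (by simpa using hz)).symm

/-- A continuous function on `𝕂 ∪ {∞}` that is the identity for `‖z‖ ≤ n + 1`. -/
noncomputable def clamp (n : ℕ) (z : OnePoint 𝕂) : 𝕂 :=
  z.elim 0 fun z => ((max 0 (min 1 (2 - ‖z‖ / (n + 1))) : ℝ) : 𝕂) * z

/-- A continuous function on `𝕂 ∪ {∞}` that vanishes for `‖z‖ ≥ n + 1` and tends to `1`. -/
noncomputable def cutoff (n : ℕ) (z : OnePoint 𝕂) : ℝ :=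
  z.elim 0 fun z => max 0 (1 - ‖z‖ / (n + 1))

theorem continuous_clamp (n : ℕ) : Continuous (clamp n : OnePoint 𝕂 → 𝕂) := by
  refine continuous_onePoint_elim ?_ (2 * (n + 1)) fun z hz => ?_
  · exact (RCLike.continuous_ofReal.comp (by fun_prop)).mul continuous_id
  · have : 2 - ‖z‖ / (n + 1) ≤ 0 := by
      rw [sub_nonpos, le_div_iff₀ (by positivity)]
      exact hz.le
    rw [max_eq_left ((min_le_right _ _).trans this), RCLike.ofReal_zero, zero_mul]

theorem continuous_cutoff (n : ℕ) : Continuous (cutoff n : OnePoint 𝕂 → ℝ) := by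
  refine continuous_onePoint_elim (by fun_prop) (n + 1) fun z hz => ?_
  have : 1 - ‖z‖ / (n + 1) ≤ 0 := by
    rw [sub_nonpos, le_div_iff₀ (by positivity), one_mul]
    exact hz.le
  rw [max_eq_left this]

theorem clamp_infty (n : ℕ) : clamp n (OnePoint.infty : OnePoint 𝕂) = 0 := rfl

theorem clamp_coe {n : ℕ} {z : 𝕂} (h : ‖z‖ ≤ n + 1) : clamp n (z : OnePoint 𝕂) = z := by
  have h1 : 1 ≤ 2 - ‖z‖ / (n + 1) := by
    have : ‖z‖ / (n + 1) ≤ 1 := (div_le_one (by positivity)).2 h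
    linarith
  change ((max 0 (min 1 (2 - ‖z‖ / (n + 1))) : ℝ) : 𝕂) * z = z
  rw [min_eq_left h1, max_eq_right zero_le_one, RCLike.ofReal_one, one_mul]

theorem cutoff_nonneg (n : ℕ) (z : OnePoint 𝕂) : 0 ≤ cutoff n z := by
  induction z using OnePoint.rec with
  | infty => exact le_rfl
  | coe z => exact le_max_left _ _

theorem cutoff_le_one (n : ℕ) (z : OnePoint 𝕂) : cutoff n z ≤ 1 := by
  induction z using OnePoint.rec with
  | infty => exact zero_le_one
  | coe z =>
    refine max_le zero_le_one ?_
    have : 0 ≤ ‖z‖ / (n + 1) := by positivity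
    linarith

theorem clamp_of_cutoff_ne_zero {n : ℕ} {z : 𝕂} (h : cutoff n (z : OnePoint 𝕂) ≠ 0) :
    clamp n (z : OnePoint 𝕂) = z := by
  refine clamp_coe ?_
  by_contra hcon
  refine h (max_eq_left ?_)
  rw [sub_nonpos, le_div_iff₀ (by positivity), one_mul]
  exact (not_le.1 hcon).le

/-- The left side equals `n + 1` at infinity, yet is bounded by `‖z‖` at finite points: this is what
shows that infinite coordinates carry no mass. -/
theorem one_sub_cutoff_mul_le (n : ℕ) (z : 𝕂) :
    (1 - cutoff n (z : OnePoint 𝕂)) * (n + 1) ≤ ‖z‖ := by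
  have h : 1 - ‖z‖ / (n + 1) ≤ cutoff n (z : OnePoint 𝕂) := le_max_right _ _
  have h2 : ‖z‖ / (n + 1) * (n + 1) = ‖z‖ := div_mul_cancel₀ _ (by positivity)
  have h3 : (0 : ℝ) < n + 1 := by positivity
  nlinarith

theorem tendsto_cutoff (z : 𝕂) :
    Filter.Tendsto (fun n => cutoff n (z : OnePoint 𝕂)) Filter.atTop (nhds 1) := by
  have h1 : Filter.Tendsto (fun n : ℕ => ‖z‖ / ((n : ℝ) + 1)) Filter.atTop (nhds 0) := by
    simpa [div_eq_mul_inv] using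
      (tendsto_one_div_add_atTop_nhds_zero_nat (𝕜 := ℝ)).const_mul ‖z‖
  have h2 : Filter.Tendsto (fun n : ℕ => max 0 (1 - ‖z‖ / ((n : ℝ) + 1))) Filter.atTop (nhds 1) := by
    simpa using (tendsto_const_nhds (x := (0 : ℝ))).max (h1.const_sub 1)
  exact h2

theorem eventually_clamp_eq (z : 𝕂) :
    ∀ᶠ n in Filter.atTop, clamp n (z : OnePoint 𝕂) = z := by
  obtain ⟨N, hN⟩ := exists_nat_ge ‖z‖
  filter_upwards [Filter.eventually_ge_atTop N] with n hn
  refine clamp_coe ?_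
  have : (N : ℝ) ≤ n := by exact_mod_cast hn
  linarith

/-- The finite part of a point of `𝕂 ∪ {∞}`. -/
def finitePart (z : OnePoint 𝕂) : 𝕂 := z.elim 0 id

theorem tendsto_clamp (z : OnePoint 𝕂) :
    Filter.Tendsto (fun n => clamp n z) Filter.atTop (nhds (finitePart z)) := by
  induction z using OnePoint.rec with
  | infty => exact tendsto_const_nhds
  | coe z => exact tendsto_const_nhds.congr' ((eventually_clamp_eq z).mono fun n hn => hn.symm)

end Cutoff

/-! ### A measure below a positive functional, by passing to ratios of coordinates -/

section BandMeasure

variable {𝕂 : Type k} [RCLike 𝕂] {X : Type u} {s : ℝ}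

/-- The coordinates of `g` relative to the coordinate `x`. -/
noncomputable def ratio (x : X) (g : X → 𝕂) (y : X) : OnePoint 𝕂 := ((g x)⁻¹ * g y : 𝕂)

theorem norm_rpow_mul_ratio {x : X} (h : HomFun 𝕂 X s) {g : X → 𝕂} (hg : g x ≠ 0) :
    ‖g x‖ ^ s * h.1 (fun y => (g x)⁻¹ * g y) = h.1 g := by
  rw [h.2.2.1, norm_inv, Real.inv_rpow (norm_nonneg _), ← mul_assoc, mul_inv_cancel₀, one_mul]
  exact (Real.rpow_pos_of_pos (norm_pos_iff.2 hg) s).ne'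

/-- A continuous function on `(𝕂 ∪ {∞})^X` that increases to `h` as `n → ∞` where the
coordinates in `F` are finite. -/
noncomputable def truncation (h : HomFun 𝕂 X s) (F : Finset X) (n : ℕ) :
    C(X → OnePoint 𝕂, ℝ) where
  toFun ω := h.1 (fun y => clamp n (ω y)) * ∏ y ∈ F, cutoff n (ω y)
  continuous_toFun := by
    refine (h.2.1.comp (continuous_pi fun y => (continuous_clamp n).comp (continuous_apply y))).mul
      (continuous_finsetProd _ fun y _ => (continuous_cutoff n).comp (continuous_apply y))

theorem truncation_nonneg {h : HomFun 𝕂 X s} (hh : ∀ g, 0 ≤ h.1 g) (F : Finset X) (n : ℕ)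
    (ω : X → OnePoint 𝕂) : 0 ≤ truncation h F n ω :=
  mul_nonneg (hh _) (Finset.prod_nonneg fun _ _ => cutoff_nonneg _ _)

theorem truncation_ratio_le (hs : 0 < s) {h : HomFun 𝕂 X s} (hh : ∀ g, 0 ≤ h.1 g) {F : Finset X}
    (hF : DependsOn h.1 F) (n : ℕ) (x : X) (g : X → 𝕂) :
    ‖g x‖ ^ s * truncation h F n (ratio x g) ≤ h.1 g := by
  obtain hg | hg := eq_or_ne (g x) 0
  · rw [hg, norm_zero, Real.zero_rpow hs.ne', zero_mul]
    exact hh g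
  · rw [← norm_rpow_mul_ratio h hg]
    gcongr
    by_cases h0 : ∃ y ∈ F, cutoff n (ratio x g y) = 0
    · obtain ⟨y, hy, hy0⟩ := h0
      have : truncation h F n (ratio x g) = 0 := by
        change _ * _ = (0 : ℝ)
        rw [Finset.prod_eq_zero hy hy0, mul_zero]
      rw [this]
      exact hh _
    · push Not at h0
      have h1 : h.1 (fun y => clamp n (ratio x g y)) = h.1 (fun y => (g x)⁻¹ * g y) :=
        hF fun y hy => clamp_of_cutoff_ne_zero (h0 y hy)
      change h.1 (fun y => clamp n (ratio x g y)) * _ ≤ _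
      rw [h1]
      exact mul_le_of_le_one_right (hh _)
        (Finset.prod_le_one (fun _ _ => cutoff_nonneg _ _) fun _ _ => cutoff_le_one _ _)

theorem tendsto_truncation {h : HomFun 𝕂 X s} {F : Finset X}
    {ω : X → OnePoint 𝕂} (hω : ∀ y ∈ F, ω y ≠ OnePoint.infty) :
    Filter.Tendsto (fun n => truncation h F n ω) Filter.atTop
      (nhds (h.1 fun y => finitePart (ω y))) := by
  have h1 : Filter.Tendsto (fun n => ∏ y ∈ F, cutoff n (ω y)) Filter.atTop (nhds 1) := by
    rw [← Finset.prod_const_one (s := F)]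
    refine tendsto_finsetProd _ fun y hy => ?_
    obtain ⟨z, hz⟩ := OnePoint.ne_infty_iff_exists.1 (hω y hy)
    rw [← hz]
    exact tendsto_cutoff z
  have h2 : Filter.Tendsto (fun n => h.1 fun y => clamp n (ω y)) Filter.atTop
      (nhds (h.1 fun y => finitePart (ω y))) :=
    (h.2.1.tendsto _).comp (tendsto_pi_nhds.2 fun y => tendsto_clamp (ω y))
  have h3 := h2.mul h1
  rw [mul_one] at h3
  exact h3

/-- A continuous function on `(𝕂 ∪ {∞})^X` that is large where the coordinate `y` is infinite. -/
noncomputable def escape (hs : 0 < s) (y : X) (n : ℕ) : C(X → OnePoint 𝕂, ℝ) where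
  toFun ω := ((1 - cutoff n (ω y)) * (n + 1)) ^ s
  continuous_toFun := by
    refine Continuous.rpow_const ?_ fun _ => Or.inr hs.le
    exact (continuous_const.sub ((continuous_cutoff n).comp (continuous_apply y))).mul
      continuous_const

theorem escape_nonneg (hs : 0 < s) (y : X) (n : ℕ) (ω : X → OnePoint 𝕂) :
    0 ≤ escape hs y n ω :=
  Real.rpow_nonneg (mul_nonneg (sub_nonneg.2 (cutoff_le_one _ _)) (by positivity)) _

theorem escape_ratio_le (hs : 0 < s) (x y : X) (n : ℕ) (g : X → 𝕂) :
    ‖g x‖ ^ s * escape hs y n (ratio x g) ≤ (powFun hs y : HomFun 𝕂 X s).1 g := by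
  obtain hg | hg := eq_or_ne (g x) 0
  · rw [hg, norm_zero, Real.zero_rpow hs.ne', zero_mul]
    exact Real.rpow_nonneg (norm_nonneg _) s
  · rw [← norm_rpow_mul_ratio (powFun hs y) hg]
    gcongr
    exact Real.rpow_le_rpow (mul_nonneg (sub_nonneg.2 (cutoff_le_one _ _)) (by positivity))
      (one_sub_cutoff_mul_le n _) hs.le

/-- The evaluation of continuous functions on `(𝕂 ∪ {∞})^X` at relative coordinates, weighted by
the `s`-th power of the coordinate `x`. -/
noncomputable def ratioEval (s : ℝ) (x : X) : C(X → OnePoint 𝕂, ℝ) →ₗ[ℝ] ((X → 𝕂) → ℝ) where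
  toFun φ g := ‖g x‖ ^ s * φ (ratio x g)
  map_add' φ ψ := by
    funext g
    simp [mul_add]
  map_smul' c φ := by
    funext g
    simp
    ring

/-- The part of a positive functional carried by the functions whose coordinate `x` does not vanish
is represented by a measure. -/
theorem exists_band_measure (hs : 0 < s) (J : HomFun 𝕂 X s →ₗ[ℝ] ℝ)
    (hJ : ∀ h : HomFun 𝕂 X s, (∀ g, 0 ≤ h.1 g) → 0 ≤ J h) {x : X} (hx : 0 < J (powFun hs x)) :
    ∃ ν : Measure (X → 𝕂), (∀ h : HomFun 𝕂 X s, (∀ g, 0 ≤ h.1 g) →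
      ∫⁻ g, ENNReal.ofReal (h.1 g) ∂ν ≤ ENNReal.ofReal (J h)) ∧
      ∫⁻ g, ENNReal.ofReal ((powFun hs x : HomFun 𝕂 X s).1 g) ∂ν ≠ 0 := by
  let _ : MeasurableSpace (X → OnePoint 𝕂) := borel _
  have : BorelSpace (X → OnePoint 𝕂) := ⟨rfl⟩
  -- Functions `φ` on the compact space become `‖g x‖^s * φ (ratio x g)`, which is majorized by
  -- `‖φ‖` times `powFun hs x`; hence `J` extends to them.
  obtain ⟨L, hL⟩ := exists_positive_extension (Submodule.subtype (HomFun 𝕂 X s)) (ratioEval s x) J hJ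
    fun φ => ⟨‖φ‖ • powFun hs x, fun g => by
      change 0 ≤ ‖φ‖ * ‖g x‖ ^ s + ‖g x‖ ^ s * φ (ratio x g)
      have h1 := neg_le_of_abs_le (φ.norm_coe_le_norm (ratio x g))
      have h2 : 0 ≤ ‖g x‖ ^ s := by positivity
      nlinarith⟩
  have hpos : ∀ φ : C(X → OnePoint 𝕂, ℝ), (∀ ω, 0 ≤ φ ω) → 0 ≤ L φ := fun φ hφ => by
    have := hL 0 φ fun g => by
      rw [map_zero, Pi.zero_apply, zero_add]
      exact mul_nonneg (by positivity) (hφ _)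
    rwa [map_zero, zero_add] at this
  have hle : ∀ (h : HomFun 𝕂 X s) (φ : C(X → OnePoint 𝕂, ℝ)),
      (∀ g, ‖g x‖ ^ s * φ (ratio x g) ≤ h.1 g) → L φ ≤ J h := fun h φ hφ => by
    have := hL h (-φ) fun g => by
      rw [map_neg]
      exact sub_nonneg.2 (hφ g)
    rw [map_neg] at this
    linarith
  have hge : ∀ (h : HomFun 𝕂 X s) (φ : C(X → OnePoint 𝕂, ℝ)),
      (∀ g, h.1 g ≤ ‖g x‖ ^ s * φ (ratio x g)) → J h ≤ L φ := fun h φ hφ => by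
    have := hL (-h) φ fun g => by
      rw [map_neg, Pi.neg_apply, neg_add_eq_sub]
      exact sub_nonneg.2 (hφ g)
    rw [map_neg] at this
    linarith
  obtain ⟨ν, hν⟩ := exists_measure_of_positive L hpos
  set T : (X → OnePoint 𝕂) → X → 𝕂 := fun ω y => finitePart (ω y) with hT
  have hclamp : ∀ (y : X) (n : ℕ), Continuous fun ω : X → OnePoint 𝕂 => clamp n (ω y) :=
    fun y n => (continuous_clamp n).comp (continuous_apply y)
  -- Each coordinate of `T` is a pointwise limit of continuous functions, hence Borel.
  have hTm : Measurable T := measurable_pi_lambda _ fun y =>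
    measurable_of_tendsto_metrizable (fun n => (hclamp y n).measurable)
      (tendsto_pi_nhds.2 fun ω => tendsto_clamp (ω y))
  -- Markov's inequality for `escape`: its value at infinity grows like `(n + 1)^s` while its
  -- integral stays below `J (powFun hs y)`.
  have hfin : ∀ y, ∀ᵐ ω ∂ν, ω y ≠ OnePoint.infty := by
    intro y
    have hbound : ∀ n : ℕ, ENNReal.ofReal ((n + 1 : ℝ) ^ s) * ν {ω | ω y = OnePoint.infty} ≤
        ENNReal.ofReal (J (powFun hs y)) := by
      intro n
      calc _ ≤ ∫⁻ ω, ENNReal.ofReal (escape hs y n ω) ∂ν := by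
            refine le_trans ?_ (mul_meas_ge_le_lintegral
              (escape hs y n).continuous.measurable.ennreal_ofReal
              (ENNReal.ofReal ((n + 1 : ℝ) ^ s)))
            refine mul_le_mul_right (measure_mono fun ω hω => ?_) _
            have h1 : escape hs y n ω = (n + 1 : ℝ) ^ s := by
              change ((1 - cutoff n (ω y)) * (n + 1 : ℝ)) ^ s = _
              rw [show ω y = OnePoint.infty from hω]
              change ((1 - 0) * (n + 1 : ℝ)) ^ s = _
              rw [sub_zero, one_mul]
            change _ ≤ ENNReal.ofReal _
            rw [h1]
        _ = ENNReal.ofReal (L (escape hs y n)) := hν _ (escape_nonneg hs y n)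
        _ ≤ _ := ENNReal.ofReal_le_ofReal (hle _ _ (escape_ratio_le hs x y n))
    change ν {ω | ¬ ω y ≠ OnePoint.infty} = 0
    simp only [not_not]
    by_contra h0
    have htop : Filter.Tendsto (fun n : ℕ => ENNReal.ofReal ((n + 1 : ℝ) ^ s) *
        ν {ω | ω y = OnePoint.infty}) Filter.atTop (nhds ∞) := by
      rw [← ENNReal.top_mul h0]
      refine ENNReal.Tendsto.mul_const (ENNReal.tendsto_ofReal_atTop.comp
        ((tendsto_rpow_atTop hs).comp ?_)) (Or.inl ENNReal.top_ne_zero)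
      exact Filter.tendsto_atTop_add_const_right _ _ tendsto_natCast_atTop_atTop
    exact absurd (le_of_tendsto' htop hbound) (by simp)
  refine ⟨ν.map T, fun h hh => ?_, ?_⟩
  · obtain ⟨F, -, hF, -⟩ := HomFun.exists_abs_le hs h
    rw [lintegral_map (HomFun.measurable h).ennreal_ofReal hTm]
    have hae : ∀ᵐ ω ∂ν, ∀ y ∈ F, ω y ≠ OnePoint.infty :=
      (Filter.eventually_all_finset F).2 fun y _ => hfin y
    -- Fatou's lemma along the truncations, each of which lies below `h` after multiplication by the
    -- weight.
    calc ∫⁻ ω, ENNReal.ofReal (h.1 (T ω)) ∂ν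
        = ∫⁻ ω, Filter.liminf (fun n => ENNReal.ofReal (truncation h F n ω)) Filter.atTop ∂ν := by
          refine lintegral_congr_ae ?_
          filter_upwards [hae] with ω hω
          exact ((ENNReal.tendsto_ofReal (tendsto_truncation (h := h) hω)).liminf_eq).symm
      _ ≤ Filter.liminf (fun n => ∫⁻ ω, ENNReal.ofReal (truncation h F n ω) ∂ν) Filter.atTop :=
          lintegral_liminf_le fun n => (truncation h F n).continuous.measurable.ennreal_ofReal
      _ ≤ ENNReal.ofReal (J h) := by
          refine Filter.liminf_le_of_le (by isBoundedDefault) fun b hb => ?_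
          obtain ⟨n, hn⟩ := hb.exists
          refine hn.trans ?_
          rw [hν _ (truncation_nonneg hh F n)]
          exact ENNReal.ofReal_le_ofReal (hle _ _ (truncation_ratio_le hs hh hF n x))
  · rw [lintegral_map (HomFun.measurable (powFun hs x : HomFun 𝕂 X s)).ennreal_ofReal hTm]
    intro hzero
    have h0 := (lintegral_eq_zero_iff
      ((HomFun.measurable (powFun hs x : HomFun 𝕂 X s)).comp hTm).ennreal_ofReal).1 hzero
    -- The coordinate `x` of `ratio x g` is `1` when `g x ≠ 0`, so `J (powFun hs x) ≤ L φ`. But `φ`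
    -- vanishes almost everywhere if that coordinate is almost everywhere `0` or infinite.
    let φ : C(X → OnePoint 𝕂, ℝ) := ⟨fun ω => ‖clamp 0 (ω x)‖,
      ((continuous_clamp 0).comp (continuous_apply x)).norm⟩
    have h1 : J (powFun hs x) ≤ L φ := hge _ _ fun g => by
      obtain hg | hg := eq_or_ne (g x) 0
      · change ‖g x‖ ^ s ≤ ‖g x‖ ^ s * _
        rw [hg, norm_zero, Real.zero_rpow hs.ne', zero_mul]
      · change ‖g x‖ ^ s ≤ ‖g x‖ ^ s * ‖clamp 0 (ratio x g x)‖
        rw [ratio, inv_mul_cancel₀ hg, clamp_coe (by simp), norm_one, mul_one]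
    have h2 := hν φ fun ω => norm_nonneg (clamp 0 (ω x))
    have h3 : ∫⁻ ω, ENNReal.ofReal (φ ω) ∂ν = 0 := by
      rw [lintegral_eq_zero_iff φ.continuous.measurable.ennreal_ofReal]
      filter_upwards [h0] with ω hω
      have h4 : ‖finitePart (ω x)‖ ^ s ≤ 0 := ENNReal.ofReal_eq_zero.1 hω
      have h5 : finitePart (ω x) = 0 := by
        by_contra hne
        exact absurd (Real.rpow_pos_of_pos (norm_pos_iff.2 hne) s) (not_lt.2 h4)
      change ENNReal.ofReal ‖clamp 0 (ω x)‖ = 0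
      generalize ω x = z at h5
      induction z using OnePoint.rec with
      | infty => simp [clamp_infty]
      | coe z =>
        obtain rfl : z = 0 := h5
        rw [clamp_coe (by simp), norm_zero, ENNReal.ofReal_zero]
    rw [h3] at h2
    have := ENNReal.ofReal_eq_zero.1 h2.symm
    linarith

end BandMeasure

/-! ### Representing a positive functional by a maximal measure -/

section Representation

variable {𝕂 : Type k} [RCLike 𝕂] {X : Type u} {s : ℝ}

theorem HomFun.integrable (hs : 0 < s) {μ : Measure (X → 𝕂)} {I : HomFun 𝕂 X s → ℝ}
    (hμ : ∀ h : HomFun 𝕂 X s, (∀ g, 0 ≤ h.1 g) →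
      ∫⁻ g, ENNReal.ofReal (h.1 g) ∂μ ≤ ENNReal.ofReal (I h)) (h : HomFun 𝕂 X s) :
    Integrable h.1 μ := by
  obtain ⟨F, K, -, hK⟩ := HomFun.exists_abs_le hs h
  have h1 := fun g => (abs_nonneg (h.1 g)).trans (hK g)
  refine Integrable.mono' (g := ((K : ℝ) • ∑ y ∈ F, powFun hs y : HomFun 𝕂 X s).1) ?_
    (HomFun.measurable h).aestronglyMeasurable (ae_of_all _ hK)
  refine ⟨(HomFun.measurable _).aestronglyMeasurable, ?_⟩
  rw [hasFiniteIntegral_iff_ofReal (ae_of_all _ h1)]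
  exact (hμ _ h1).trans_lt ENNReal.ofReal_lt_top

/-- A positive functional on the homogeneous functions is represented by a measure. -/
theorem exists_measure_of_positive_homFun (hs : 0 < s) (I : HomFun 𝕂 X s →ₗ[ℝ] ℝ)
    (hI : ∀ h : HomFun 𝕂 X s, (∀ g, 0 ≤ h.1 g) → 0 ≤ I h) :
    ∃ μ : Measure (X → 𝕂),
      (∀ x, ∫⁻ g, ENNReal.ofReal (‖g x‖ ^ s) ∂μ ≤ ENNReal.ofReal (I (powFun hs x))) ∧
      ∀ z : X × X, ∫⁻ g, ENNReal.ofReal (‖g z.1 - g z.2‖ ^ s) ∂μ =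
        ENNReal.ofReal (I (subPowFun hs z)) := by
  obtain ⟨μ, hμ, hmax⟩ := zorn_le₀ {μ : Measure (X → 𝕂) | ∀ h : HomFun 𝕂 X s, (∀ g, 0 ≤ h.1 g) →
    ∫⁻ g, ENNReal.ofReal (h.1 g) ∂μ ≤ ENNReal.ofReal (I h)} fun c hcs hc => by
      obtain ⟨m, hm, hB⟩ := exists_measure_upperBound hc
      exact ⟨m, fun h hh => hB _ _ fun μ hμ => hcs hμ h hh, hm⟩
  have hint := HomFun.integrable hs hμ
  have hof : ∀ h : HomFun 𝕂 X s, (∀ g, 0 ≤ h.1 g) →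
      ∫⁻ g, ENNReal.ofReal (h.1 g) ∂μ = ENNReal.ofReal (∫ g, h.1 g ∂μ) := fun h hh =>
    (ofReal_integral_eq_lintegral_ofReal (hint h) (ae_of_all _ hh)).symm
  -- The part of `I` not yet represented by the maximal measure `μ`; it is positive.
  let J : HomFun 𝕂 X s →ₗ[ℝ] ℝ :=
    { toFun := fun h => I h - ∫ g, h.1 g ∂μ
      map_add' := fun h h' => by
        have : ∫ g, (h + h').1 g ∂μ = ∫ g, h.1 g ∂μ + ∫ g, h'.1 g ∂μ :=
          integral_add (hint h) (hint h')
        rw [map_add, this]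
        ring
      map_smul' := fun c h => by
        have : ∫ g, (c • h).1 g ∂μ = c * ∫ g, h.1 g ∂μ := integral_const_mul c h.1
        rw [map_smul, this, smul_eq_mul, smul_eq_mul, RingHom.id_apply]
        ring }
  have hJdef : ∀ h, J h = I h - ∫ g, h.1 g ∂μ := fun _ => rfl
  have hJ : ∀ h : HomFun 𝕂 X s, (∀ g, 0 ≤ h.1 g) → 0 ≤ J h := fun h hh => by
    have h1 := hμ h hh
    rw [hof h hh, ENNReal.ofReal_le_ofReal_iff (hI h hh)] at h1
    exact sub_nonneg.2 h1
  have hpow0 : ∀ x (g : X → 𝕂), 0 ≤ (powFun hs x : HomFun 𝕂 X s).1 g := fun x g =>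
    Real.rpow_nonneg (norm_nonneg _) s
  have hsub0 : ∀ z (g : X → 𝕂), 0 ≤ (subPowFun hs z : HomFun 𝕂 X s).1 g := fun z g =>
    Real.rpow_nonneg (norm_nonneg _) s
  have hJpow : ∀ x, J (powFun hs x) = 0 := fun x => by
    by_contra hne
    obtain ⟨ν, hν, hν0⟩ := exists_band_measure hs J hJ ((hJ _ (hpow0 x)).lt_of_ne' hne)
    refine hν0 ?_
    have hmem : ∀ h : HomFun 𝕂 X s, (∀ g, 0 ≤ h.1 g) →
        ∫⁻ g, ENNReal.ofReal (h.1 g) ∂(μ + ν) ≤ ENNReal.ofReal (I h) := fun h hh => by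
      rw [lintegral_add_measure, hof h hh]
      refine (add_le_add_right (hν h hh) _).trans_eq ?_
      rw [← ENNReal.ofReal_add (integral_nonneg hh) (hJ h hh), hJdef, add_sub_cancel]
    have h1 : ∫⁻ g, ENNReal.ofReal ((powFun hs x : HomFun 𝕂 X s).1 g) ∂(μ + ν) ≤
        ∫⁻ g, ENNReal.ofReal ((powFun hs x : HomFun 𝕂 X s).1 g) ∂μ :=
      lintegral_mono' (hmax hmem (Measure.le_add_right le_rfl)) le_rfl
    rw [lintegral_add_measure, hof _ (hpow0 x)] at h1
    exact nonpos_iff_eq_zero.1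
      ((ENNReal.add_le_add_iff_left ENNReal.ofReal_ne_top).1 (h1.trans_eq (add_zero _).symm))
  refine ⟨μ, fun x => hμ _ (hpow0 x), fun z => ?_⟩
  -- Since `J` is positive and kills the coordinate powers, it kills whatever they majorize.
  have h1 := hJ ((2 : ℝ) ^ s • (powFun hs z.1 + powFun hs z.2) - subPowFun hs z) fun g =>
    sub_nonneg.2 (norm_sub_rpow_le hs.le (g z.1) (g z.2))
  rw [map_sub, map_smul, map_add, hJpow, hJpow, add_zero, smul_zero, zero_sub,
    Left.nonneg_neg_iff] at h1
  have h2 := h1.antisymm (hJ _ (hsub0 z))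
  rw [hJdef, sub_eq_zero] at h2
  rw [h2]
  exact hof _ (hsub0 z)

end Representation

/-! ### Factorization through `L_{p'}` of the representing measure -/

section Factorization

variable {𝕂 : Type k} [RCLike 𝕂] {X : Type u} [MetricSpace X] {x₀ : X}
  {E : Type v} [NormedAddCommGroup E] [NormedSpace 𝕂 E]

/-- Linear combinations with coefficients `α` are sums over a finite family. -/
theorem Finsupp.exists_fin_sum {ι : Type*} (α : ι →₀ ℝ≥0) :
    ∃ (n : ℕ) (t : Fin n → ι) (a : Fin n → ℝ≥0), ∀ l : ι → ℝ,
      Finsupp.linearCombination ℝ≥0 l α = ∑ i, (a i : ℝ) * l (t i) := by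
  refine ⟨_, fun i => (α.support.equivFin.symm i).1, fun i => α (α.support.equivFin.symm i).1,
    fun l => ?_⟩
  rw [Finsupp.linearCombination_apply, Finsupp.sum, ← Finset.sum_coe_sort,
    ← α.support.equivFin.symm.sum_comp]
  rfl

theorem norm_toLp_rpow_inv_mul {q : ℝ≥0∞} [Fact (1 ≤ q)] (hq : q ≠ ∞) {n : ℕ} {F G : Type*}
    [NormedAddCommGroup F] [NormedAddCommGroup G] (a : Fin n → ℝ≥0) (t : Fin n → F) (v : Fin n → G)
    (h : ∀ i, ‖t i‖ = (a i : ℝ) ^ q.toReal⁻¹ * ‖v i‖) :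
    ‖WithLp.toLp q t‖ ^ q.toReal = ∑ i, (a i : ℝ) * ‖v i‖ ^ q.toReal := by
  rw [norm_toLp_rpow hq]
  refine Finset.sum_congr rfl fun i _ => ?_
  rw [h, Real.mul_rpow (by positivity) (norm_nonneg _), ← Real.rpow_mul (NNReal.coe_nonneg _),
    inv_mul_cancel₀ (toReal_pos_of_fact hq).ne', Real.rpow_one]

/-- A nonnegative coefficient `α` is `(α^(1/s))^s`, so pointwise inequalities between combinations
of the functions `|g x - g y|^s` are exactly dominations `≺_s`, and the discrete inequality for `f`
supplies the compatibility condition. -/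
theorem AlphaBound.exists_functional {p : ℝ≥0∞} [Fact (1 ≤ p)] (hp : p ≠ 1)
    (hq : p.conjExponent ≠ ∞) (hs : 0 < p.conjExponent.toReal)
    {f : X → StrongDual 𝕂 E} {C : ℝ} (hC : 0 ≤ C)
    (hf : AlphaBound (wNorm p : Tensor 𝕂 E x₀ → ℝ) f C) :
    ∃ I : HomFun 𝕂 X p.conjExponent.toReal →ₗ[ℝ] ℝ, (∀ h, (∀ g, 0 ≤ h.1 g) → 0 ≤ I h) ∧
      ∀ z : X × X, ‖f z.1 - f z.2‖ ^ p.conjExponent.toReal ≤ I (subPowFun hs z) ∧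
        I (subPowFun hs z) ≤ (C * dist z.1 z.2) ^ p.conjExponent.toReal := by
  set s := p.conjExponent.toReal with hsdef
  let ev : HomFun 𝕂 X s →ₗ[ℝ] (Lip0 𝕂 x₀ 𝕂 → ℝ) :=
    { toFun := fun h g => h.1 g.1
      map_add' := fun _ _ => rfl
      map_smul' := fun _ _ => rfl }
  have hev : ∀ (β : X × X →₀ ℝ≥0) (g : Lip0 𝕂 x₀ 𝕂),
      ev (Finsupp.linearCombination ℝ≥0 (subPowFun hs) β) g =
        Finsupp.linearCombination ℝ≥0 (fun z : X × X => ‖g.1 z.1 - g.1 z.2‖ ^ s) β := fun β g => by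
    rw [Finsupp.linearCombination_apply, Finsupp.linearCombination_apply, Finsupp.sum, Finsupp.sum,
      map_sum, Finset.sum_apply]
    rfl
  obtain ⟨I, hI, hI'⟩ := exists_positive_functional ev (subPowFun hs)
    (fun z => ‖f z.1 - f z.2‖ ^ s) (fun z => (C * dist z.1 z.2) ^ s) (fun h => by
      obtain ⟨F, K, -, hK⟩ := HomFun.exists_abs_le hs h
      -- Since `g x₀ = 0`, the power `‖g y‖^s` is the increment power of the pair `(y, x₀)`.
      refine ⟨∑ y ∈ F, Finsupp.single (y, x₀) K, fun g => ?_⟩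
      rw [map_add, Pi.add_apply, hev, map_sum]
      have h1 := hK g.1
      have h2 : ((K : ℝ) • ∑ y ∈ F, powFun hs y : HomFun 𝕂 X s).1 g.1 =
          ∑ y ∈ F, Finsupp.linearCombination ℝ≥0 (fun z : X × X => ‖g.1 z.1 - g.1 z.2‖ ^ s)
            (Finsupp.single (y, x₀) K) := by
        have h3 : ((K : ℝ) • ∑ y ∈ F, powFun hs y : HomFun 𝕂 X s).1 g.1 =
            (K : ℝ) * ∑ y ∈ F, ‖g.1 y‖ ^ s := by
          simp [powFun, Finset.sum_apply]
        rw [h3, Finset.mul_sum]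
        refine Finset.sum_congr rfl fun y _ => ?_
        rw [Finsupp.linearCombination_single, g.2.1, sub_zero]
        rfl
      rw [← h2]
      have h3 := neg_le_of_abs_le h1
      change 0 ≤ h.1 g.1 + _
      linarith) (fun α β hαβ => by
      obtain ⟨n, t, a, ha⟩ := Finsupp.exists_fin_sum α
      obtain ⟨m, r, b, hb⟩ := Finsupp.exists_fin_sum β
      have hpow : ∀ c : ℝ≥0, |(c : ℝ) ^ s⁻¹| = (c : ℝ) ^ s⁻¹ := fun c =>
        abs_of_nonneg (by positivity)
      have hdom : Dominated 𝕂 x₀ p.conjExponent (fun i => (a i : ℝ) ^ s⁻¹) (fun i => (t i).1)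
          (fun i => (t i).2) (fun j => (b j : ℝ) ^ s⁻¹) (fun j => (r j).1) (fun j => (r j).2) := by
        intro g hg
        rw [← Real.rpow_le_rpow_iff (norm_nonneg _) (norm_nonneg _) hs,
          norm_toLp_rpow_inv_mul hq a _ (fun i => g (t i).1 - g (t i).2)
            fun i => by rw [norm_mul, RCLike.norm_ofReal, hpow],
          norm_toLp_rpow_inv_mul hq b _ (fun j => g (r j).1 - g (r j).2)
            fun j => by rw [norm_mul, RCLike.norm_ofReal, hpow]]
        have h1 := hαβ ⟨g, hg⟩
        rw [hev, hev, ha, hb] at h1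
        exact h1
      have h1 := hf.norm_toLp_le hp hC hdom
      have h2 := Real.rpow_le_rpow (norm_nonneg _) h1 hs.le
      rw [Real.mul_rpow hC (norm_nonneg _),
        norm_toLp_rpow_inv_mul hq a _ (fun i => f (t i).1 - f (t i).2)
          fun i => by rw [norm_mul, norm_norm, hpow, Real.norm_of_nonneg (by positivity)],
        norm_toLp_rpow_inv_mul hq b _ (fun j => dist (r j).1 (r j).2)
          fun j => by rw [norm_mul, Real.norm_eq_abs, hpow], Finset.mul_sum] at h2
      rw [ha, hb]
      refine h2.trans_eq (Finset.sum_congr rfl fun j _ => ?_)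
      rw [Real.norm_of_nonneg dist_nonneg, Real.mul_rpow hC dist_nonneg]
      ring)
  exact ⟨I, fun h hh => hI h fun g => hh g.1, hI'⟩

/-- The map `R` sends `x` to evaluation at `x`, a function on `𝕂^X`, so `‖R x - R y‖^s` is the value
of `I` at `|g x - g y|^s`. The lift only adjusts the universe. -/
theorem AlphaBound.exists_mem_factorCosts {p : ℝ≥0∞} [Fact (1 ≤ p)] (hp : p ≠ 1)
    (hq : p.conjExponent ≠ ∞) {f : X → StrongDual 𝕂 E} {C : ℝ} (hC : 0 ≤ C)
    (hf : AlphaBound (wNorm p : Tensor 𝕂 E x₀ → ℝ) f C) :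
    ∃ c ∈ factorCosts.{u, max v k, max u k w, k} 𝕂 p.conjExponent f, c ≤ C := by
  have hs := toReal_pos_of_fact hq
  have hq0 : p.conjExponent ≠ 0 := fun h => by simp [h] at hs
  obtain ⟨I, hI, hI'⟩ := hf.exists_functional hp hq hs hC
  obtain ⟨μ, hμ, hμ'⟩ := exists_measure_of_positive_homFun hs I hI
  let up : (X → 𝕂) ≃ᵐ ULift.{max u k w} (X → 𝕂) := MeasurableEquiv.ulift.symm
  have hmeas : ∀ x, Measurable fun ω : ULift.{max u k w} (X → 𝕂) => ω.down x := fun x =>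
    (measurable_pi_apply x).comp measurable_down
  have hlp : ∀ x, MemLp (fun ω : ULift.{max u k w} (X → 𝕂) => ω.down x) p.conjExponent
      (μ.map up) := fun x => by
    refine ⟨(hmeas x).aestronglyMeasurable, ?_⟩
    rw [eLpNorm_lt_top_iff_lintegral_rpow_enorm_lt_top hq0 hq, lintegral_map_equiv]
    refine lt_of_eq_of_lt (lintegral_congr fun g => ?_) ((hμ x).trans_lt ENNReal.ofReal_lt_top)
    rw [← ENNReal.ofReal_rpow_of_nonneg (norm_nonneg _) hs.le, ofReal_norm]
    rfl
  let R : X → Lp 𝕂 p.conjExponent (μ.map up) := fun x => (hlp x).toLp _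
  have hR : ∀ x y, ‖R x - R y‖ ^ p.conjExponent.toReal = I (subPowFun hs (x, y)) := fun x y => by
    have h1 : ‖R x - R y‖ₑ ^ p.conjExponent.toReal = ENNReal.ofReal (I (subPowFun hs (x, y))) := by
      rw [enorm_sub_rpow_eq_lintegral hq, ← hμ' (x, y)]
      calc _ = ∫⁻ ω : ULift.{max u k w} (X → 𝕂),
            ‖ω.down x - ω.down y‖ₑ ^ p.conjExponent.toReal ∂(μ.map up) := by
            refine lintegral_congr_ae ?_
            filter_upwards [(hlp x).coeFn_toLp, (hlp y).coeFn_toLp] with ω h1 h2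
            rw [h1, h2]
        _ = _ := by
            rw [lintegral_map_equiv]
            refine lintegral_congr fun g => ?_
            rw [← ENNReal.ofReal_rpow_of_nonneg (norm_nonneg _) hs.le, ofReal_norm]
            rfl
    rw [← ofReal_norm, ENNReal.ofReal_rpow_of_nonneg (norm_nonneg _) hs.le,
      ENNReal.ofReal_eq_ofReal_iff (by positivity)
        (hI _ fun g => Real.rpow_nonneg (norm_nonneg _) _)] at h1
    exact h1
  refine exists_mem_factorCosts_le (K := ⟨C, hC⟩) R (LipschitzWith.of_dist_le_mul fun x y => ?_)
    fun x y => ?_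
  · rw [dist_eq_norm, ← Real.rpow_le_rpow_iff (norm_nonneg _) (by positivity) hs, hR]
    exact (hI' (x, y)).2
  · rw [dist_eq_norm, dist_eq_norm, ← Real.rpow_le_rpow_iff (norm_nonneg _) (norm_nonneg _) hs, hR]
    exact (hI' (x, y)).1

end Factorization

/-! ### Equality of the spaces and of the norms -/

section Main

variable {𝕂 : Type k} [RCLike 𝕂] {X : Type u} [MetricSpace X] {x₀ : X}
  {E : Type v} [NormedAddCommGroup E] [NormedSpace 𝕂 E] {p q : ℝ≥0∞} [Fact (1 ≤ p)] [Fact (1 ≤ q)]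

theorem AlphaBound.exists_mem_factorCosts_conjExponent (hpq : p.conjExponent = q)
    {f : X → StrongDual 𝕂 E} {C : ℝ} (hC : 0 ≤ C)
    (hf : AlphaBound (wNorm p : Tensor 𝕂 E x₀ → ℝ) f C) :
    ∃ c ∈ factorCosts.{u, max v k, max u k w, k} 𝕂 q f, c ≤ C := by
  obtain rfl | hp := eq_or_ne p 1
  · obtain rfl : q = ∞ := by rw [← hpq]; simp [ENNReal.conjExponent]
    exact exists_mem_factorCosts_top_le (K := ⟨C, hC⟩) (LipschitzWith.of_dist_le_mul fun x y => by
      rw [dist_eq_norm]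
      exact hf.norm_sub_le (isLipschitzCrossNorm_wNorm 1) hC x y)
  · subst hpq
    refine hf.exists_mem_factorCosts hp (fun h => hp ?_) hC
    have h1 : p.HolderConjugate p.conjExponent := inferInstance
    rw [h] at h1
    exact ENNReal.HolderConjugate.unique ∞ p 1

theorem alphaLip_wNorm (hpq : p.conjExponent = q) :
    alphaLip (wNorm p : Tensor 𝕂 E x₀ → ℝ) =
      Gam.{u, max v k, max u k w, k} 𝕂 q x₀ (0 : StrongDual 𝕂 E) := by
  ext f
  constructor
  · rintro ⟨hf, C, hC, hfC⟩
    obtain ⟨c, hc, -⟩ := hfC.exists_mem_factorCosts_conjExponent.{u, v, w, k} hpq hC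
    exact ⟨hf, exists_lipschitz_of_mem_factorCosts hc, c, hc⟩
  · rintro ⟨hf, hL, c, hc⟩
    subst hpq
    obtain ⟨h0, h1⟩ := alphaBound_of_mem_factorCosts (x₀ := x₀) p ⟨f, hf, hL⟩ hc
    exact ⟨hf, c, h0, h1⟩

theorem alphaLipNorm_wNorm (hpq : p.conjExponent = q) {f : X → StrongDual 𝕂 E}
    (hf : f ∈ alphaLip (wNorm p : Tensor 𝕂 E x₀ → ℝ)) :
    alphaLipNorm (wNorm p : Tensor 𝕂 E x₀ → ℝ) f =
      gam.{u, max v k, max u k w, k} 𝕂 q f := by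
  obtain ⟨hf0, C, hC, hfC⟩ := hf
  have h1 : ∀ c ∈ factorCosts.{u, max v k, max u k w, k} 𝕂 q f,
      0 ≤ c ∧ AlphaBound (wNorm p : Tensor 𝕂 E x₀ → ℝ) f c := fun c hc => by
    subst hpq
    exact alphaBound_of_mem_factorCosts p ⟨f, hf0, exists_lipschitz_of_mem_factorCosts hc⟩ hc
  obtain ⟨c, hc, -⟩ := hfC.exists_mem_factorCosts_conjExponent.{u, v, w, k} hpq hC
  refine le_antisymm (le_csInf ⟨c, hc⟩ fun c hc => csInf_le ⟨0, fun _ h => h.1⟩ (h1 c hc))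
    (le_csInf ⟨C, hC, hfC⟩ fun D hD => ?_)
  obtain ⟨d, hd, hdD⟩ := hD.2.exists_mem_factorCosts_conjExponent.{u, v, w, k} hpq hD.1
  exact (csInf_le ⟨0, fun _ h => (h1 _ h).1⟩ hd).trans hdD

end Main

end LipTensor

theorem mainTheorem12 {𝕂 : Type k} [RCLike 𝕂]
    {X : Type u} [MetricSpace X] (x₀ : X)
    {E : Type v} [NormedAddCommGroup E] [NormedSpace 𝕂 E] [CompleteSpace E]
    (p : ℝ≥0∞) [Fact (1 ≤ p)] :
    alphaLip (wNorm p : Tensor 𝕂 E x₀ → ℝ) =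
        Gam.{u, max v k, max u k w, k} 𝕂 p.conjExponent x₀ (0 : StrongDual 𝕂 E) ∧
    (∀ f ∈ alphaLip (wNorm p : Tensor 𝕂 E x₀ → ℝ),
        alphaLipNorm (wNorm p : Tensor 𝕂 E x₀ → ℝ) f =
          gam.{u, max v k, max u k w, k} 𝕂 p.conjExponent f) ∧
    ∃ (h : IsLipschitzCrossNorm (wNorm p.conjExponent : Tensor 𝕂 E x₀ → ℝ))
      (V : Submodule 𝕂 (X → StrongDual 𝕂 E))
      (Λ : V ≃ₗ[𝕂] StrongDual 𝕂 (CompletedTensor h)),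
      (V : Set (X → StrongDual 𝕂 E)) =
        Gam.{u, max v k, max u k w, k} 𝕂 p x₀ (0 : StrongDual 𝕂 E) ∧
      (∀ f : V, ‖Λ f‖ = gam.{u, max v k, max u k w, k} 𝕂 p (f : X → StrongDual 𝕂 E)) ∧
      ∀ (f : V) (x y : X) (e : E),
        Λ f (completedDelta h x y e) = ((f : X → StrongDual 𝕂 E) x - (f : X → StrongDual 𝕂 E) y) e := by
  -- Conjugating twice returns `p`, so the first part at the exponent `p'` identifies the dual with
  -- `Γ_p`.
  have hpp : p.conjExponent.conjExponent = p :=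
    have : p.conjExponent.HolderConjugate p := ENNReal.HolderConjugate.symm (p := p)
    ENNReal.HolderConjugate.conjExponent_eq
  have h := isLipschitzCrossNorm_wNorm (𝕂 := 𝕂) (E := E) (x₀ := x₀) p.conjExponent
  exact ⟨alphaLip_wNorm.{u, v, w, k} rfl, fun f hf => alphaLipNorm_wNorm.{u, v, w, k} rfl hf, h,
    alphaLipSubmodule h, alphaLipDualEquiv h, alphaLip_wNorm.{u, v, w, k} hpp,
    fun f => (norm_alphaLipDualEquiv h f).trans (alphaLipNorm_wNorm.{u, v, w, k} hpp f.2),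
    alphaLipDualEquiv_completedDelta h⟩
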